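/- All simplicial complexes are finite and abstract, the empty set is a face of each of them, and isomorphic complexes are identified. Definitions. For a finite set $\alpha$ let $\overline{\alpha}$ (resp. $\partial\alpha$) be the complex of all subsets (resp. all proper subsets) of $\alpha$, and let $*$ denote the join. The standard $d$-sphere $S^{d}_{d+2}$ is $\partial\sigma$ with $\#\sigma=d+2$. Let $X$ be a $d$-dimensional simplicial complex and let $\alpha,\beta$ be disjoint non-empty finite sets with $\dim\alpha+\dim\beta=d$ (where $\dim\alpha=\#\alpha-1$) such that the subcomplex of $X$ induced on $\alpha\sqcup\beta$ is $\overline{\alpha}*\partial\beta$. If $Y=(X\setminus(\overline{\alpha}*\partial\beta))\cup(\partial\alpha*\overline{\beta})$ is a simplicial complex, it is said to be obtained from $X$ by the bistellar move $\alpha\mapsto\beta$, of index $\dim\beta$ (in a move of index $0$, $\beta$ is a new vertex, not in $X$). A $d$-dimensional simplicial complex is $k$-stellated if it is obtained from $S^{d}_{d+2}$ by a finite (possibly empty) sequence of bistellar moves, each of index $<k$; in particular $S^{d}_{d+2}$ is the only $0$-stellated one. For $d\ge 1$ and $0\le k\le d$, $\mathcal{W}_k(d)$ is the class of connected $d$-dimensional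 simplicial complexes all of whose vertex links are $k$-stellated of dimension $d-1$. A complex is $l$-neighbourly if any $l$ of its vertices form a face. A polytope is the convex hull of a finite set of points in some $\mathbb{R}^n$; it is simplicial if all its proper faces are simplices. A polytopal sphere of dimension $d$ is a complex isomorphic to the boundary complex $\partial P=\{A\subseteq V(P): \operatorname{conv}(A)\text{ is a proper face of }P\}$ of a simplicial polytope $P$ of dimension $d+1$, where $V(P)$ is the set of vertices of $P$. Proposition. Let $k\ge 0$ and let $S$ be a $(k+1)$-neighbourly polytopal sphere of dimension $2k+1$. Then $S\in\mathcal{W}_k(2k+1)$; that is, $S$ is a connected simplicial complex of dimension $2k+1$, and the link of each vertex of $S$ is a $k$-stellated complex (sphere) of dimension $2k$. -/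

import Mathlib

/-! ### Convex polytopes -/

/-- A (convex) polytope: the convex hull of a finite set of points. -/
def IsPolytope {n : ℕ} (P : Set (EuclideanSpace ℝ (Fin n))) : Prop :=
  ∃ s : Finset (EuclideanSpace ℝ (Fin n)), P = convexHull ℝ (s : Set (EuclideanSpace ℝ (Fin n)))

/-- A proper face of `P`: a face, i.e. the intersection of `P` with a supporting hyperplane
(possibly empty), other than `P` itself. -/
def IsProperFace {n : ℕ} (P F : Set (EuclideanSpace ℝ (Fin n))) : Prop :=
  IsExposed ℝ P F ∧ F ≠ P

/-- A geometric simplex: the convex hull of a finite affinely independent set of points. -/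
def IsGeometricSimplex {n : ℕ} (F : Set (EuclideanSpace ℝ (Fin n))) : Prop :=
  ∃ s : Finset (EuclideanSpace ℝ (Fin n)),
    AffineIndependent ℝ (fun x : s => (x : EuclideanSpace ℝ (Fin n))) ∧
      F = convexHull ℝ (s : Set (EuclideanSpace ℝ (Fin n)))

/-- A simplicial polytope: a polytope all of whose proper faces are simplices. -/
def IsSimplicialPolytope {n : ℕ} (P : Set (EuclideanSpace ℝ (Fin n))) : Prop :=
  IsPolytope P ∧ ∀ F, IsProperFace P F → IsGeometricSimplex F

/-- The (nonempty) faces of the boundary complex of `P`: the nonempty sets `A` of vertices of `P`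
such that `conv A` is a proper face of `P`. The vertices of `P` are its zero-dimensional faces,
that is, its exposed points. -/
def boundaryFaces {n : ℕ} (P : Set (EuclideanSpace ℝ (Fin n))) :
    Set (Finset (EuclideanSpace ℝ (Fin n))) :=
  {A | A.Nonempty ∧ (A : Set (EuclideanSpace ℝ (Fin n))) ⊆ P.exposedPoints ℝ ∧
    IsProperFace P (convexHull ℝ (A : Set (EuclideanSpace ℝ (Fin n))))}

/-- Two families of finite sets are isomorphic if some map, injective on the points occurring in
the first family, carries the first family onto the second one. -/
def FaceIsomorphic {V W : Type*} (F : Set (Finset V)) (G : Set (Finset W)) : Prop :=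
  ∃ f : V → W, Set.InjOn f {v | ∃ A ∈ F, v ∈ A} ∧
    ∀ B : Finset W, B ∈ G ↔ ∃ A ∈ F, (B : Set W) = f '' (A : Set V)

/-! ### Abstract simplicial complexes

The faces of a `PreAbstractSimplicialComplex` are its *nonempty* faces; the empty face, which every
complex has, is left implicit. A point `v` of the ambient type is a vertex if `{v}` is a face. -/

namespace PreAbstractSimplicialComplex

/-- The complex `K` has dimension `d`. -/
def HasDim {V : Type*} (K : PreAbstractSimplicialComplex V) (d : ℕ) : Prop :=
  (∀ A ∈ K.faces, A.card ≤ d + 1) ∧ ∃ A ∈ K.faces, A.card = d + 1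

/-- The complex `K` is `l`-neighbourly: any `l` vertices of `K` form a face. -/
def IsNeighbourly {V : Type*} (K : PreAbstractSimplicialComplex V) (l : ℕ) : Prop :=
  ∀ A : Finset V, A.Nonempty → (∀ v ∈ A, {v} ∈ K.faces) → A.card = l → A ∈ K.faces

/-- The link of `x` in `K`. -/
def link {V : Type*} [DecidableEq V] (K : PreAbstractSimplicialComplex V) (x : V) :
    PreAbstractSimplicialComplex V where
  faces := {A | A.Nonempty ∧ x ∉ A ∧ insert x A ∈ K.faces}
  isRelLowerSet_faces := fun _ hA =>
    ⟨hA.1, fun _ hB hBne => ⟨hBne, fun h => hA.2.1 (hB h),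
      (K.isRelLowerSet_faces hA.2.2).2 (Finset.insert_subset_insert x hB)
        (Finset.insert_nonempty _ _)⟩⟩

/-- The edge graph of `K`, on the vertices of `K`. -/
def edgeGraph {V : Type*} [DecidableEq V] (K : PreAbstractSimplicialComplex V) :
    SimpleGraph {v : V // {v} ∈ K.faces} where
  Adj u v := u ≠ v ∧ {(u : V), (v : V)} ∈ K.faces
  symm := ⟨fun u v h => ⟨h.1.symm, by rw [Finset.pair_comm]; exact h.2⟩⟩
  loopless := ⟨fun _ h => h.1 rfl⟩

/-- A simplicial complex is connected if and only if its edge graph is. -/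
def IsConnected {V : Type*} [DecidableEq V] (K : PreAbstractSimplicialComplex V) : Prop :=
  K.edgeGraph.Connected

/-- The boundary complex `∂σ` of the simplex on the finite set `σ`: all proper subsets of `σ`. -/
def simplexBoundary {V : Type*} (σ : Finset V) : PreAbstractSimplicialComplex V where
  faces := {A | A.Nonempty ∧ A ⊂ σ}
  isRelLowerSet_faces := fun _ hA =>
    ⟨hA.1, fun _ hB hBne => ⟨hBne, lt_of_le_of_lt hB hA.2⟩⟩

/-- For disjoint `α` and `β`, the join of the full simplex on `α` with `∂β`: its faces are the
disjoint unions of a subset of `α` and a proper subset of `β`, i.e. the subsets of `α ∪ β` that do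
not contain `β`. -/
def simplexJoinBoundary {V : Type*} [DecidableEq V] (α β : Finset V) :
    PreAbstractSimplicialComplex V where
  faces := {A | A.Nonempty ∧ A ⊆ α ∪ β ∧ ¬ β ⊆ A}
  isRelLowerSet_faces := fun _ hA =>
    ⟨hA.1, fun _ hB hBne => ⟨hBne, hB.trans hA.2.1, fun h => hA.2.2 (h.trans hB)⟩⟩

/-- The `d`-dimensional complex `Y` is obtained from the `d`-dimensional complex `X` by the
bistellar move `α ↦ β`, whose index is `dim β = #β - 1`: the subcomplex of `X` induced on the set
`α ⊔ β` is the join of the full simplex on `α` with `∂β`, and `Y` arises from `X` by replacing it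
with the join of `∂α` and the full simplex on `β`. -/
structure IsBistellarMove {V : Type*} [DecidableEq V] (d : ℕ) (X Y : PreAbstractSimplicialComplex V)
    (α β : Finset V) : Prop where
  dim : X.HasDim d
  nonempty_left : α.Nonempty
  nonempty_right : β.Nonempty
  disjoint : Disjoint α β
  card_add : α.card + β.card = d + 2
  induced : {A | A ∈ X.faces ∧ A ⊆ α ∪ β} = (simplexJoinBoundary α β).faces
  result : Y.faces = (X.faces \ (simplexJoinBoundary α β).faces) ∪ (simplexJoinBoundary β α).faces

/-- `Y` is obtained from `X` (both of dimension `d`) by one bistellar move of index `< k`. -/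
def BistellarStep {V : Type*} [DecidableEq V] (d k : ℕ) (X Y : PreAbstractSimplicialComplex V) :
    Prop :=
  ∃ α β : Finset V, IsBistellarMove d X Y α β ∧ β.card - 1 < k

/-- The complex `X` is `k`-stellated of dimension `d`: up to isomorphism, it is obtained from the
standard `d`-sphere, the boundary complex of a simplex with `d + 2` vertices, by finitely many
bistellar moves of index `< k`. Up to isomorphism the vertices may be taken in `ℕ`, where a new
vertex is always available. -/
def IsStellated {V : Type*} (k d : ℕ) (X : PreAbstractSimplicialComplex V) : Prop :=
  ∃ (σ : Finset ℕ) (Y : PreAbstractSimplicialComplex ℕ), σ.card = d + 2 ∧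
    Relation.ReflTransGen (BistellarStep d k) (simplexBoundary σ) Y ∧
    FaceIsomorphic X.faces Y.faces

/-- The class `W_k(d)`, for `d ≥ 1`: the (finite) connected simplicial complexes of dimension `d`
all of whose vertex links are `k`-stellated of dimension `d - 1`. -/
structure MemW {V : Type*} [DecidableEq V] (k d : ℕ) (X : PreAbstractSimplicialComplex V) :
    Prop where
  one_le_dim : 1 ≤ d
  finite : X.faces.Finite
  connected : X.IsConnected
  dim : X.HasDim d
  link_stellated : ∀ v : V, {v} ∈ X.faces → IsStellated k (d - 1) (X.link v)

/-- The complex `X` is a polytopal `d`-sphere: it is isomorphic to the boundary complex of a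
simplicial polytope of dimension `d + 1`. -/
def IsPolytopalSphere {V : Type*} (d : ℕ) (X : PreAbstractSimplicialComplex V) : Prop :=
  ∃ (n : ℕ) (P : Set (EuclideanSpace ℝ (Fin n))), IsSimplicialPolytope P ∧
    Module.finrank ℝ (vectorSpan ℝ P) = d + 1 ∧ FaceIsomorphic X.faces (boundaryFaces P)

end PreAbstractSimplicialComplex

/-! The link of a vertex `v` of a simplicial polytope is the boundary of the region of
`∂ conv (N \ {v})`, with `N` the set of vertices, that is visible from `v`. Let the viewpoint move
from `v` along a generic ray into the interior, crossing one facet hyperplane at a time, so that the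
visible facets disappear one by one. If the point where the hyperplane of a facet `F` is crossed is
written as a combination of the vertices of `F`, with coefficients positive on `α` and negative on
`β`, then read backwards this crossing is the bistellar move `α ↦ β`; the sequence of moves starts
from the boundary of the last visible facet. If `α` were a face of the polytope, a functional
exposing it would be positive at the crossing point, which lies in the polytope. Hence
`(k + 1)`-neighbourliness in dimension `2 k + 2` gives `#α ≥ k + 2`, so the move has index less than
`k`. Neighbourliness also puts the vertices in general position. -/

section Exposes

variable {ι W : Type*} [AddCommGroup W] [Module ℝ W]

/-- The set `A` of points of the vector configuration `p` on `N` is exposed by the functional `φ`: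
it is the subset of `N` on which `φ` attains its maximum, and this maximum is `0`. For the
homogenised points `p i = (x i, 1)` these are the faces of the convex hull of the `x i`, and `φ`
stands for an affine function. -/
structure Exposes (p : ι → W) (N A : Finset ι) (φ : Module.Dual ℝ W) : Prop where
  subset : A ⊆ N
  eq_zero : ∀ i ∈ A, φ (p i) = 0
  neg : ∀ i ∈ N, i ∉ A → φ (p i) < 0

variable {p : ι → W} {N A : Finset ι} {φ ψ : Module.Dual ℝ W}

theorem Exposes.nonpos (h : Exposes p N A φ) : ∀ i ∈ N, φ (p i) ≤ 0 := fun i hi => by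
  by_cases hA : i ∈ A
  · exact (h.eq_zero i hA).le
  · exact (h.neg i hi hA).le

theorem Exposes.exists_neg (h : Exposes p N A φ) (hA : A ≠ N) :
    ∃ i ∈ N, i ∉ A ∧ φ (p i) < 0 := by
  obtain ⟨i, hi, hiA⟩ := Finset.exists_of_ssubset (h.subset.ssubset_of_ne hA)
  exact ⟨i, hi, hiA, h.neg i hi hiA⟩

theorem exposes_filter_of_nonpos (h : ∀ i ∈ N, φ (p i) ≤ 0) :
    Exposes p N {i ∈ N | φ (p i) = 0} φ where
  subset := Finset.filter_subset _ _
  eq_zero _ hi := (Finset.mem_filter.1 hi).2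
  neg i hi hA := (h i hi).lt_of_ne fun h0 => hA (Finset.mem_filter.2 ⟨hi, h0⟩)

theorem Exposes.erase [DecidableEq ι] (h : Exposes p N A φ) (a : ι) :
    Exposes p (N.erase a) (A.erase a) φ where
  subset := Finset.erase_subset_erase a h.subset
  eq_zero i hi := h.eq_zero i (Finset.mem_of_mem_erase hi)
  neg i hi hA := h.neg i (Finset.mem_of_mem_erase hi) fun hiA =>
    hA (Finset.mem_erase.2 ⟨Finset.ne_of_mem_erase hi, hiA⟩)

/-- Tilting `φ` in the direction `ψ` until the supporting hyperplane hits a new point. -/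
theorem Exposes.exists_pivot (h : Exposes p N A φ) (hA : A ≠ N) (hψ : ∀ i ∈ A, ψ (p i) = 0) :
    ∃ (s : ℝ) (F : Finset ι), A ⊂ F ∧ Exposes p N F (ψ + s • φ) := by
  classical
  have hne : (N \ A).Nonempty :=
    Finset.sdiff_nonempty.2 fun hNA => hA (h.subset.antisymm hNA)
  obtain ⟨i, hi, hmax⟩ := Finset.exists_max_image (N \ A) (fun i => ψ (p i) / -φ (p i)) hne
  obtain ⟨hiN, hiA⟩ := Finset.mem_sdiff.1 hi
  refine ⟨ψ (p i) / -φ (p i), _, ?_, exposes_filter_of_nonpos fun j hj => ?_⟩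
  · refine (Finset.ssubset_iff_of_subset fun j hj => ?_).2 ⟨i, ?_, hiA⟩
    · simp [h.subset hj, hψ j hj, h.eq_zero j hj]
    · have := (h.neg i hiN hiA).ne
      simp only [Finset.mem_filter, hiN, true_and, LinearMap.add_apply, LinearMap.smul_apply,
        smul_eq_mul]
      field_simp
      ring
  · by_cases hjA : j ∈ A
    · simp [hψ j hjA, h.eq_zero j hjA]
    · have hle := hmax j (Finset.mem_sdiff.2 ⟨hj, hjA⟩)
      rw [div_le_iff₀ (neg_pos.2 (h.neg j hj hjA))] at hle
      simp only [LinearMap.add_apply, LinearMap.smul_apply, smul_eq_mul]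
      linarith

theorem coeff_eq_zero_of_sum_smul_eq_zero {m : ℕ} {B : Finset ι} {c : ι → ℝ}
    (h : ∀ A ⊆ N, A.card ≤ m → ∃ φ, Exposes p N A φ) (hB : B ⊆ N)
    (hc : ∑ i ∈ B, c i • p i = 0) (hcard : (B.filter (0 < c ·)).card ≤ m) :
    ∀ i ∈ B, c i = 0 := by
  have relation (φ : Module.Dual ℝ W) : ∑ i ∈ B, c i * φ (p i) = 0 := by
    simpa using congrArg φ hc
  have hnonneg : ∀ i ∈ B, 0 ≤ c i := by
    obtain ⟨φ, hφ⟩ := h _ ((Finset.filter_subset _ B).trans hB) hcard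
    by_contra! hneg
    obtain ⟨i, hi, hci⟩ := hneg
    have hterm : ∀ j ∈ B, 0 ≤ c j * φ (p j) := fun j hj => by
      rcases lt_or_ge 0 (c j) with hj' | hj'
      · rw [hφ.eq_zero j (Finset.mem_filter.2 ⟨hj, hj'⟩), mul_zero]
      · exact mul_nonneg_of_nonpos_of_nonpos hj' (hφ.nonpos j (hB hj))
    have := mul_pos_of_neg_of_neg hci (hφ.neg i (hB hi) fun hmem =>
      (Finset.mem_filter.1 hmem).2.not_gt hci)
    exact this.ne' ((Finset.sum_eq_zero_iff_of_nonneg hterm).1 (relation φ) i hi)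
  obtain ⟨φ, hφ⟩ := h ∅ (Finset.empty_subset N) (by simp)
  have hneg : ∀ i ∈ B, φ (p i) < 0 := fun i hi => hφ.neg i (hB hi) (Finset.notMem_empty i)
  have hzero := (Finset.sum_eq_zero_iff_of_nonpos fun i hi =>
    mul_nonpos_of_nonneg_of_nonpos (hnonneg i hi) (hneg i hi).le).1 (relation φ)
  exact fun i hi => (mul_eq_zero.1 (hzero i hi)).resolve_right (hneg i hi).ne

theorem linearIndepOn_of_exposes {m : ℕ} {B : Finset ι}
    (h : ∀ A ⊆ N, A.card ≤ m → ∃ φ, Exposes p N A φ) (hB : B ⊆ N) (hcard : B.card ≤ 2 * m + 1) :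
    LinearIndepOn ℝ p (B : Set ι) := by
  classical
  rw [linearIndepOn_finset_iff]
  intro c hc
  have hdisj : Disjoint (B.filter (0 < c ·)) (B.filter (0 < (-c) ·)) :=
    Finset.disjoint_filter.2 fun i _ hi => by simpa using hi.le
  have hle := Finset.card_le_card (Finset.union_subset (Finset.filter_subset (0 < c ·) B)
    (Finset.filter_subset (0 < (-c) ·) B))
  rw [Finset.card_union_of_disjoint hdisj] at hle
  rcases le_or_gt (B.filter (0 < c ·)).card m with hpos | hpos
  · exact coeff_eq_zero_of_sum_smul_eq_zero h hB hc hpos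
  · have hc' : ∑ i ∈ B, (-c) i • p i = 0 := by simp [hc]
    intro i hi
    simpa using coeff_eq_zero_of_sum_smul_eq_zero h hB hc' (by omega) i hi

end Exposes

section GeneralPosition

variable {ι W : Type*} [AddCommGroup W] [Module ℝ W]

/-- General position of the vector configuration `p` on `N`: there are at least `dim W` vectors,
and any `dim W` of them are linearly independent. For homogenised points this is affine general
position. -/
structure GeneralPosition (p : ι → W) (N : Finset ι) : Prop where
  finrank_le_card : Module.finrank ℝ W ≤ N.card
  linearIndepOn : ∀ A ⊆ N, A.card ≤ Module.finrank ℝ W → LinearIndepOn ℝ p (A : Set ι)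

/-- The facets of the vector configuration `p` on `N`, assumed to be in general position: the
exposed subsets with `dim W - 1` elements. -/
def facets (p : ι → W) (N : Finset ι) : Set (Finset ι) :=
  {F | F.card + 1 = Module.finrank ℝ W ∧ ∃ φ, Exposes p N F φ}

open Classical in
/-- An outer normal of the facet `F`, unique up to a positive factor; junk if `F` is not exposed. -/
noncomputable def facetNormal (p : ι → W) (N F : Finset ι) : Module.Dual ℝ W :=
  if h : ∃ φ, Exposes p N F φ then h.choose else 0

/-- The facets whose hyperplanes separate the viewpoint `x` from the configuration. -/
def visibleFacets (p : ι → W) (N : Finset ι) (x : W) : Set (Finset ι) :=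
  {G ∈ facets p N | 0 < facetNormal p N G x}

variable {p : ι → W} {N A F : Finset ι} {φ ψ : Module.Dual ℝ W}

theorem exposes_facetNormal (hF : F ∈ facets p N) : Exposes p N F (facetNormal p N F) := by
  rw [facetNormal, dif_pos hF.2]
  exact hF.2.choose_spec

theorem finite_facets : (facets p N).Finite :=
  N.powerset.finite_toSet.subset fun _ hF =>
    Finset.mem_coe.2 (Finset.mem_powerset.2 hF.2.choose_spec.subset)

namespace GeneralPosition

theorem erase [DecidableEq ι] (h : GeneralPosition p N) (hN : Module.finrank ℝ W < N.card) (a : ι) :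
    GeneralPosition p (N.erase a) where
  finrank_le_card := (Nat.le_sub_one_of_lt hN).trans Finset.pred_card_le_card_erase
  linearIndepOn A hA := h.linearIndepOn A (hA.trans (Finset.erase_subset a N))

theorem exists_dual_eq (h : GeneralPosition p N) (hA : A ⊆ N)
    (hcard : A.card ≤ Module.finrank ℝ W) (g : ι → ℝ) :
    ∃ φ : Module.Dual ℝ W, ∀ i ∈ A, φ (p i) = g i := by
  have hli : LinearIndependent ℝ fun i : (A : Set ι) => p i := h.linearIndepOn A hA hcard
  obtain ⟨φ, hφ⟩ := ((Module.Basis.span hli).constr ℝ fun i => g i).exists_extend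
  refine ⟨φ, fun i hi => ?_⟩
  have := LinearMap.congr_fun hφ (Module.Basis.span hli ⟨i, hi⟩)
  rwa [Module.Basis.constr_basis, LinearMap.comp_apply, Submodule.subtype_apply,
    Module.Basis.span_apply] at this

theorem ne_of_mem_facets (h : GeneralPosition p N) (hF : F ∈ facets p N) : F ≠ N := by
  rintro rfl
  have := h.finrank_le_card
  have := hF.1
  omega

variable [FiniteDimensional ℝ W]

theorem card_lt_finrank (h : GeneralPosition p N) (hA : A ⊆ N) (hφ : φ ≠ 0)
    (hzero : ∀ i ∈ A, φ (p i) = 0) : A.card < Module.finrank ℝ W := by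
  by_contra! hle
  obtain ⟨B, hBA, hB⟩ := Finset.exists_subset_card_eq hle
  have hli : LinearIndependent ℝ fun i : B => p i := h.linearIndepOn B (hBA.trans hA) hB.le
  have hspan := hli.span_eq_top_of_card_eq_finrank' (by simpa using hB)
  refine hφ (LinearMap.ext_on_range hspan fun i => ?_)
  simpa using hzero i (hBA i.2)

theorem card_lt_finrank_of_exposes (h : GeneralPosition p N) (hφ : Exposes p N A φ) (hA : A ≠ N) :
    A.card < Module.finrank ℝ W := by
  refine h.card_lt_finrank hφ.subset (fun h0 => hA ?_) hφ.eq_zero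
  by_contra hne
  obtain ⟨i, -, -, hi⟩ := hφ.exists_neg hne
  simp [h0] at hi

theorem exists_eq_smul (h : GeneralPosition p N)
    (hF : F.card + 1 = Module.finrank ℝ W) (hφ : Exposes p N F φ)
    (hψ : ∀ i ∈ F, ψ (p i) = 0) : ∃ t : ℝ, ψ = t • φ := by
  classical
  obtain ⟨i, hi, hiF, hneg⟩ := hφ.exists_neg (h.ne_of_mem_facets ⟨hF, φ, hφ⟩)
  refine ⟨ψ (p i) / φ (p i), sub_eq_zero.1 (by_contra fun hne => ?_)⟩
  have hlt := h.card_lt_finrank (A := insert i F) (Finset.insert_subset hi hφ.subset) hne ?_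
  · rw [Finset.card_insert_of_notMem hiF] at hlt
    omega
  · rintro j hj
    rcases Finset.mem_insert.1 hj with rfl | hj
    · simp [hneg.ne]
    · simp [hφ.eq_zero j hj, hψ j hj]

theorem exists_eq_smul_facetNormal (h : GeneralPosition p N)
    (hF : F.card + 1 = Module.finrank ℝ W) (hφ : Exposes p N F φ) :
    ∃ t : ℝ, 0 < t ∧ φ = t • facetNormal p N F := by
  have hF' : F ∈ facets p N := ⟨hF, φ, hφ⟩
  have hn := exposes_facetNormal hF'
  obtain ⟨t, rfl⟩ := h.exists_eq_smul hF hn hφ.eq_zero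
  obtain ⟨i, hi, hiF, hneg⟩ := hn.exists_neg (h.ne_of_mem_facets hF')
  exact ⟨t, pos_of_mul_neg_left (hφ.neg i hi hiF) hneg.le, rfl⟩

theorem exists_facet (h : GeneralPosition p N) (hφ : Exposes p N A φ) (hA : A ≠ N) :
    ∃ F ∈ facets p N, A ⊆ F := by
  classical
  obtain ⟨F, hAF, hmax⟩ := (N.powerset.filter fun B => B ≠ N ∧ ∃ ψ, Exposes p N B ψ)
    |>.exists_le_maximal (a := A) (by simpa [hφ.subset, hA] using ⟨φ, hφ⟩)
  obtain ⟨hFN, χ, hF⟩ := (Finset.mem_filter.1 hmax.prop).2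
  refine ⟨F, ⟨le_antisymm (h.card_lt_finrank_of_exposes hF hFN) ?_, χ, hF⟩, hAF⟩
  by_contra! hlt
  obtain ⟨i, hi, hiF, hneg⟩ := hF.exists_neg hFN
  have hiN : insert i F ⊆ N := Finset.insert_subset hi hF.subset
  have hcard := Finset.card_insert_of_notMem hiF
  obtain ⟨j, hj, hjF⟩ := Finset.exists_mem_notMem_of_card_lt_card
    ((hcard.trans_lt hlt).trans_le h.finrank_le_card)
  obtain ⟨ψ, hψ⟩ := h.exists_dual_eq (Finset.insert_subset hj hiN)
    (by rw [Finset.card_insert_of_notMem hjF, hcard]; omega) (Pi.single j 1)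
  have hψi : ∀ a ∈ insert i F, ψ (p a) = 0 := fun a ha => by
    rw [hψ a (Finset.mem_insert_of_mem ha), Pi.single_eq_of_ne (ne_of_mem_of_not_mem ha hjF)]
  obtain ⟨s, G, hFG, hG⟩ := hF.exists_pivot hFN fun a ha => hψi a (Finset.mem_insert_of_mem ha)
  have hGN : G = N := by
    by_contra hne
    exact hFG.2 (hmax.le_of_ge (Finset.mem_filter.2 ⟨Finset.mem_powerset.2 hG.subset, hne, _, hG⟩)
      hFG.1)
  rw [hGN] at hG
  -- The tilted functional vanishes at `i`, so it was not tilted at all, and it vanishes at `j`.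
  have hs : s = 0 := by
    simpa [hψi i (Finset.mem_insert_self i F), hneg.ne] using hG.eq_zero i hi
  simpa [hs, hψ j (Finset.mem_insert_self j _)] using hG.eq_zero j hj

theorem exists_facet_erase [DecidableEq ι] (h : GeneralPosition p N) (hF : F ∈ facets p N) {a : ι}
    (ha : a ∈ F) {ε : ℝ} (hε : ε ≠ 0) :
    ∃ (G : Finset ι) (ψ : Module.Dual ℝ W), F.erase a ⊆ G ∧ G.card + 1 = Module.finrank ℝ W ∧
      Exposes p (N.erase a) G ψ ∧ ψ (p a) = ε := by
  have hn := exposes_facetNormal hF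
  have haN := hn.subset ha
  obtain ⟨ψ, hψ⟩ := h.exists_dual_eq hn.subset (by have := hF.1; omega) (Pi.single a ε)
  have hne : F.erase a ≠ N.erase a := fun heq => h.ne_of_mem_facets hF <| by
    rw [← Finset.insert_erase ha, heq, Finset.insert_erase haN]
  obtain ⟨s, G, hFG, hG⟩ := (hn.erase a).exists_pivot (ψ := ψ) hne fun i hi => by
    rw [hψ i (Finset.mem_of_mem_erase hi), Pi.single_eq_of_ne (Finset.ne_of_mem_erase hi)]
  have hval : (ψ + s • facetNormal p N F) (p a) = ε := by
    simp [hψ a ha, hn.eq_zero a ha]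
  refine ⟨G, _, hFG.1, ?_, hG, hval⟩
  have hlt := h.card_lt_finrank (hG.subset.trans (Finset.erase_subset a N))
    (fun h0 => hε (by rw [← hval, h0, LinearMap.zero_apply])) hG.eq_zero
  have hgt := Finset.card_lt_card hFG
  rw [Finset.card_erase_of_mem ha] at hgt
  have := hF.1
  omega

theorem exists_adjacent_facet [DecidableEq ι] (h : GeneralPosition p N) (hF : F ∈ facets p N)
    {a : ι} (ha : a ∈ F) :
    ∃ G ∈ facets p N, F.erase a ⊆ G ∧ a ∉ G := by
  obtain ⟨G, ψ, hFG, hG, hψ, hψa⟩ := h.exists_facet_erase hF ha (neg_ne_zero.2 one_ne_zero)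
  refine ⟨G, ⟨hG, ψ, hψ.subset.trans (Finset.erase_subset a N), hψ.eq_zero, fun i hi hiG => ?_⟩,
    hFG, fun haG => Finset.notMem_erase a N (hψ.subset haG)⟩
  rcases eq_or_ne i a with rfl | hia
  · simp [hψa]
  · exact hψ.neg i (Finset.mem_erase.2 ⟨hia, hi⟩) hiG

theorem exists_sum_smul_of_facetNormal_eq_zero (h : GeneralPosition p N) (hF : F ∈ facets p N)
    {x : W} (hx : facetNormal p N F x = 0) : ∃ c : ι → ℝ, x = ∑ a ∈ F, c a • p a := by
  have hn := exposes_facetNormal hF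
  have hne : facetNormal p N F ≠ 0 := fun h0 => by
    obtain ⟨i, -, -, hi⟩ := hn.exists_neg (h.ne_of_mem_facets hF)
    simp [h0] at hi
  have hle : Submodule.span ℝ (p '' F) ≤ LinearMap.ker (facetNormal p N F) :=
    Submodule.span_le.2 (Set.image_subset_iff.2 hn.eq_zero)
  have hli : LinearIndependent ℝ fun i : (F : Set ι) => p i :=
    h.linearIndepOn F hn.subset (by have := hF.1; omega)
  have hspan : Submodule.span ℝ (p '' F) = LinearMap.ker (facetNormal p N F) := by
    refine Submodule.eq_of_le_of_finrank_eq hle ?_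
    have hker := Module.Dual.finrank_ker_add_one_of_ne_zero hne
    rw [Set.image_eq_range, finrank_span_eq_card hli]
    have := hF.1
    simp only [Finset.coe_sort_coe, Fintype.card_coe]
    omega
  obtain ⟨c, hc⟩ := (Submodule.mem_span_image_finset_iff_exists_fun' ℝ).1 (hspan.ge hx)
  exact ⟨c, hc.symm⟩

theorem exists_visible_facet_iff (h : GeneralPosition p N) (hF : F ∈ facets p N)
    (c : ι → ℝ) (hA : A ⊆ F) :
    (∃ G ∈ visibleFacets p N (∑ a ∈ F, c a • p a), A ⊆ G) ↔ ¬ {a ∈ F | c a < 0} ⊆ A := by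
  classical
  constructor
  · rintro ⟨G, ⟨hG, hpos⟩, hAG⟩ hneg
    have hn := exposes_facetNormal hG
    simp only [map_sum, map_smul, smul_eq_mul] at hpos
    refine hpos.not_ge (Finset.sum_nonpos fun a ha => ?_)
    rcases lt_or_ge (c a) 0 with hca | hca
    · rw [hn.eq_zero a (hAG (hneg (Finset.mem_filter.2 ⟨ha, hca⟩))), mul_zero]
    · exact mul_nonpos_of_nonneg_of_nonpos hca (hn.nonpos a ((exposes_facetNormal hF).subset ha))
  · intro hneg
    obtain ⟨a, ha, haA⟩ := Finset.not_subset.1 hneg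
    obtain ⟨haF, hca⟩ := Finset.mem_filter.1 ha
    obtain ⟨G, hG, hFG, haG⟩ := h.exists_adjacent_facet hF haF
    have hn := exposes_facetNormal hG
    refine ⟨G, ⟨hG, ?_⟩, (Finset.subset_erase.2 ⟨hA, haA⟩).trans hFG⟩
    simp only [map_sum, map_smul, smul_eq_mul]
    rw [Finset.sum_eq_single_of_mem a haF fun b hb hba => by
      rw [hn.eq_zero b (hFG (Finset.mem_erase.2 ⟨hba, hb⟩)), mul_zero]]
    exact mul_pos_of_neg_of_neg hca (hn.neg a ((exposes_facetNormal hF).subset haF) haG)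

theorem coeff_ne_zero (h : GeneralPosition p N) (hF : F ∈ facets p N) {c : ι → ℝ}
    (hc : ∀ G ∈ facets p N, G ≠ F → facetNormal p N G (∑ a ∈ F, c a • p a) ≠ 0) :
    ∀ a ∈ F, c a ≠ 0 := by
  classical
  intro a ha hca
  obtain ⟨G, hG, hFG, haG⟩ := h.exists_adjacent_facet hF ha
  refine hc G hG (fun hGF => haG (hGF ▸ ha)) ?_
  rw [map_sum]
  refine Finset.sum_eq_zero fun b hb => ?_
  rcases eq_or_ne b a with rfl | hba
  · rw [hca, zero_smul, map_zero]
  · rw [map_smul, (exposes_facetNormal hG).eq_zero b (hFG (Finset.mem_erase.2 ⟨hba, hb⟩)),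
      smul_zero]

end GeneralPosition

end GeneralPosition

section SeparatingComplex

open PreAbstractSimplicialComplex

variable {ι : Type*}

/-- For a family `𝓕` of facets and a subfamily `𝓥`, the complex of the faces common to the
subcomplexes generated by `𝓥` and by `𝓕 \ 𝓥`. When `𝓕` consists of the facets of a polytope and `𝓥`
of those visible from a point, it is the boundary of the visible region. -/
def separatingComplex (𝓕 𝓥 : Set (Finset ι)) : PreAbstractSimplicialComplex ι where
  faces := {A | A.Nonempty ∧ (∃ G ∈ 𝓥, A ⊆ G) ∧ ∃ H ∈ 𝓕 \ 𝓥, A ⊆ H}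
  isRelLowerSet_faces := fun _ ⟨hne, ⟨G, hG, hAG⟩, H, hH, hAH⟩ =>
    ⟨hne, fun _ hB hBne => ⟨hBne, ⟨G, hG, hB.trans hAG⟩, H, hH, hB.trans hAH⟩⟩

variable {𝓕 𝓥 : Set (Finset ι)} {d : ℕ} {F : Finset ι}

theorem separatingComplex_hasDim [DecidableEq ι] (hcard : ∀ G ∈ 𝓕, G.card = d + 1 + 1)
    (h𝓥 : 𝓥 ⊆ 𝓕) (hF : F ∈ 𝓕 \ 𝓥) {a : ι} (ha : a ∈ F) (hvis : ∃ G ∈ 𝓥, F.erase a ⊆ G) :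
    (separatingComplex 𝓕 𝓥).HasDim d := by
  have hFa : (F.erase a).card = d + 1 := by rw [Finset.card_erase_of_mem ha, hcard F hF.1]; rfl
  refine ⟨fun A ⟨_, ⟨G, hG, hAG⟩, H, hH, hAH⟩ => ?_, F.erase a,
    ⟨Finset.card_pos.1 (by omega), hvis, F, hF, Finset.erase_subset a F⟩, hFa⟩
  refine Nat.le_of_lt_succ (lt_of_le_of_ne ((Finset.card_le_card hAG).trans_eq
    (hcard G (h𝓥 hG))) fun hA => hH.2 ?_)
  rwa [← Finset.eq_of_subset_of_card_le hAH (by rw [hcard H hH.1, hA]),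
    Finset.eq_of_subset_of_card_le hAG (by rw [hcard G (h𝓥 hG), hA])]

/-- Shelling step: if the boundary of the next facet `F = α ∪ β` meets the region `𝓥` in
`α * ∂β` and the rest in `∂α * β`, then adding `F` to `𝓥` changes the separating complex by the
bistellar move `α ↦ β`. -/
theorem isBistellarMove_separatingComplex [DecidableEq ι] {α β : Finset ι}
    (hcard : ∀ G ∈ 𝓕, G.card = d + 2) (h𝓥 : 𝓥 ⊆ 𝓕) (hF : F ∈ 𝓕) (hαβ : Disjoint α β)
    (hunion : α ∪ β = F) (hα : α.Nonempty) (hβ : β.Nonempty)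
    (hin : ∀ A ⊆ F, (∃ G ∈ 𝓥, A ⊆ G) ↔ ¬ β ⊆ A)
    (hout : ∀ A ⊆ F, (∃ H ∈ 𝓕 \ insert F 𝓥, A ⊆ H) ↔ ¬ α ⊆ A) :
    IsBistellarMove d (separatingComplex 𝓕 𝓥) (separatingComplex 𝓕 (insert F 𝓥)) α β := by
  have hβF : β ⊆ F := hunion ▸ Finset.subset_union_right
  have hF𝓥 : F ∉ 𝓥 := fun hF' => (hin F subset_rfl).1 ⟨F, hF', subset_rfl⟩ hβF
  have hout' {A : Finset ι} : (∃ H ∈ 𝓕 \ 𝓥, A ⊆ H) ↔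
      A ⊆ F ∨ ∃ H ∈ 𝓕 \ insert F 𝓥, A ⊆ H := by
    constructor
    · rintro ⟨H, hH, hAH⟩
      rcases eq_or_ne H F with rfl | hne
      exacts [Or.inl hAH, Or.inr ⟨H, ⟨hH.1, fun h => h.elim hne hH.2⟩, hAH⟩]
    · rintro (hAF | ⟨H, hH, hAH⟩)
      exacts [⟨F, ⟨hF, hF𝓥⟩, hAF⟩, ⟨H, ⟨hH.1, fun h => hH.2 (Or.inr h)⟩, hAH⟩]
  have hin' {A : Finset ι} : (∃ G ∈ insert F 𝓥, A ⊆ G) ↔ A ⊆ F ∨ ∃ G ∈ 𝓥, A ⊆ G := by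
    simp only [Set.mem_insert_iff, exists_eq_or_imp]
  obtain ⟨b, hb⟩ := hβ
  refine ⟨separatingComplex_hasDim hcard h𝓥 ⟨hF, hF𝓥⟩ (hβF hb) ?_, hα, ⟨b, hb⟩, hαβ, ?_, ?_, ?_⟩
  · exact (hin _ (Finset.erase_subset b F)).2 fun h => Finset.notMem_erase b F (h hb)
  · rw [← Finset.card_union_of_disjoint hαβ, hunion, hcard F hF]
  · ext A
    change (A.Nonempty ∧ (∃ G ∈ 𝓥, A ⊆ G) ∧ ∃ H ∈ 𝓕 \ 𝓥, A ⊆ H) ∧ A ⊆ α ∪ β ↔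
      A.Nonempty ∧ A ⊆ α ∪ β ∧ ¬ β ⊆ A
    rw [hunion, hout']
    by_cases hAF : A ⊆ F
    · simp only [hAF, hin A hAF, true_or, and_true, true_and]
    · simp only [hAF, and_false, false_and]
  · ext A
    change (A.Nonempty ∧ (∃ G ∈ insert F 𝓥, A ⊆ G) ∧ ∃ H ∈ 𝓕 \ insert F 𝓥, A ⊆ H) ↔
      ((A.Nonempty ∧ (∃ G ∈ 𝓥, A ⊆ G) ∧ ∃ H ∈ 𝓕 \ 𝓥, A ⊆ H) ∧
        ¬ (A.Nonempty ∧ A ⊆ α ∪ β ∧ ¬ β ⊆ A)) ∨ (A.Nonempty ∧ A ⊆ β ∪ α ∧ ¬ α ⊆ A)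
    rw [Finset.union_comm β α, hunion, hout', hin']
    by_cases hAF : A ⊆ F
    · simp only [hAF, hin A hAF, hout A hAF, true_or, true_and, and_true]
      tauto
    · simp only [hAF, false_or, false_and, and_false, or_false, not_false_eq_true, and_true]

end SeparatingComplex

theorem reflTransGen_of_sweep {κ : Type*} {s : Set κ} (hs : s.Finite) {τ : κ → ℝ}
    (hτ : s.InjOn τ) {R : Set κ → Set κ → Prop} {t₀ : ℝ}
    (hR : ∀ a ∈ s, t₀ < τ a → {b ∈ s | τ a < τ b}.Nonempty →
      R {b ∈ s | τ a < τ b} (insert a {b ∈ s | τ a < τ b}))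
    (hne : {b ∈ s | t₀ < τ b}.Nonempty) :
    ∃ a ∈ s, Relation.ReflTransGen R {a} {b ∈ s | t₀ < τ b} := by
  induction hn : {b ∈ s | t₀ < τ b}.ncard using Nat.strong_induction_on generalizing t₀ with
  | _ n ih =>
    obtain ⟨a, ⟨has, hta⟩, hmin⟩ := Set.exists_min_image _ τ (hs.subset (Set.sep_subset _ _)) hne
    have hinsert : {b ∈ s | t₀ < τ b} = insert a {b ∈ s | τ a < τ b} := by
      ext b
      refine ⟨fun hb => ?_, ?_⟩
      · rcases (hmin b hb).eq_or_lt with hab | hab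
        exacts [Or.inl (hτ hb.1 has hab.symm), Or.inr ⟨hb.1, hab⟩]
      · rintro (rfl | hb)
        exacts [⟨has, hta⟩, ⟨hb.1, hta.trans hb.2⟩]
    rw [hinsert]
    rcases {b ∈ s | τ a < τ b}.eq_empty_or_nonempty with hempty | hnext
    · exact ⟨a, has, by rw [hempty, insert_empty_eq]⟩
    · have hlt : {b ∈ s | τ a < τ b}.ncard < n := by
        rw [← hn, hinsert]
        exact Set.ncard_lt_ncard (Set.ssubset_insert fun h => lt_irrefl _ h.2)
          ((hs.subset (Set.sep_subset _ _)).insert a)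
      obtain ⟨c, hc, hreach⟩ := ih _ hlt (fun b hb hab => hR b hb (hta.trans hab)) hnext rfl
      exact ⟨c, hc, hreach.tail (hR a has hta hnext)⟩

section Sweep

open PreAbstractSimplicialComplex

variable {ι W : Type*} [AddCommGroup W] [Module ℝ W] {p : ι → W} {N A : Finset ι}
  {φ : Module.Dual ℝ W}

theorem exists_pos_weights {T : Set (Module.Dual ℝ W)} (hT : T.Finite)
    (h : ∀ ψ ∈ T, ∃ i ∈ N, ψ (p i) ≠ 0) :
    ∃ w : ι → ℝ, (∀ i ∈ N, 0 < w i) ∧ ∀ ψ ∈ T, ψ (∑ i ∈ N, w i • p i) ≠ 0 := by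
  have := hT.to_subtype
  obtain ⟨x, hx, hTx⟩ := Module.Dual.exists_forall_mem_ne_zero_of_forall_exists
    (Submodule.span ℝ (p '' N)) ((↑) : T → Module.Dual ℝ W) fun ψ => by
      obtain ⟨i, hi, hψi⟩ := h ψ ψ.2
      exact ⟨p i, Submodule.subset_span (Set.mem_image_of_mem p hi), hψi⟩
  obtain ⟨u, rfl⟩ := (Submodule.mem_span_image_finset_iff_exists_fun' ℝ).1 hx
  have hval (ψ : Module.Dual ℝ W) (t : ℝ) : ψ (∑ i ∈ N, (u i + t) • p i) =
      ψ (∑ i ∈ N, u i • p i) + t * ψ (∑ i ∈ N, p i) := by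
    simp only [add_smul, Finset.sum_add_distrib, ← Finset.smul_sum, map_add, map_smul, smul_eq_mul]
  have hpos : ∀ᶠ t in Filter.atTop, ∀ i ∈ N, 0 < u i + t :=
    N.eventually_all.2 fun i _ => (Filter.eventually_gt_atTop (-u i)).mono fun t ht => by linarith
  have hne : ∀ᶠ t in Filter.atTop, ∀ ψ ∈ T, ψ (∑ i ∈ N, (u i + t) • p i) ≠ 0 := by
    refine (Filter.eventually_all_finite hT).2 fun ψ hψ => ?_
    have hsub : {t : ℝ | ψ (∑ i ∈ N, (u i + t) • p i) = 0}.Subsingleton := fun t ht t' ht' => by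
      rw [Set.mem_ofPred_eq, hval] at ht ht'
      have hmul : (t - t') * ψ (∑ i ∈ N, p i) = 0 := by linear_combination ht - ht'
      refine sub_eq_zero.1 ((mul_eq_zero.1 hmul).resolve_right fun h0 => hTx ⟨ψ, hψ⟩ ?_)
      simpa [h0] using ht
    exact Filter.atTop_le_cofinite hsub.finite.compl_mem_cofinite
  obtain ⟨t, ht, ht'⟩ := (hpos.and hne).exists
  exact ⟨fun i => u i + t, ht, ht'⟩

theorem Exposes.apply_sum_nonpos (h : Exposes p N A φ) {w : ι → ℝ} (hw : ∀ i ∈ N, 0 < w i) :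
    φ (∑ i ∈ N, w i • p i) ≤ 0 := by
  simp only [map_sum, map_smul, smul_eq_mul]
  exact Finset.sum_nonpos fun i hi => mul_nonpos_of_nonneg_of_nonpos (hw i hi).le (h.nonpos i hi)

theorem Exposes.apply_sum_neg (h : Exposes p N A φ) (hA : A ≠ N) {w : ι → ℝ}
    (hw : ∀ i ∈ N, 0 < w i) : φ (∑ i ∈ N, w i • p i) < 0 := by
  obtain ⟨i, hi, -, hneg⟩ := h.exists_neg hA
  simp only [map_sum, map_smul, smul_eq_mul]
  exact Finset.sum_neg' (fun j hj => mul_nonpos_of_nonneg_of_nonpos (hw j hj).le (h.nonpos j hj))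
    ⟨i, hi, mul_neg_of_pos_of_neg (hw i hi) hneg⟩

theorem Exposes.apply_sum_pos {F : Finset ι} {c : ι → ℝ}
    (h : Exposes p N {a ∈ F | 0 < c a} φ) (hF : F ⊆ N) {b : ι} (hb : b ∈ F) (hcb : c b < 0) :
    0 < φ (∑ a ∈ F, c a • p a) := by
  have hterm : ∀ a ∈ F, c a < 0 → 0 < c a * φ (p a) := fun a ha hca =>
    mul_pos_of_neg_of_neg hca (h.neg a (hF ha) fun hmem => (Finset.mem_filter.1 hmem).2.not_gt hca)
  simp only [map_sum, map_smul, smul_eq_mul]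
  refine Finset.sum_pos' (fun a ha => ?_) ⟨b, hb, hterm b hb hcb⟩
  rcases lt_trichotomy (c a) 0 with hca | hca | hca
  · exact (hterm a ha hca).le
  · rw [hca, zero_mul]
  · rw [h.eq_zero a (Finset.mem_filter.2 ⟨ha, hca⟩), mul_zero]

theorem dual_apply_add_smul {x c : W} (hc : φ c ≠ 0) (t : ℝ) :
    φ (x + t • c) = -φ c * (φ x / -φ c - t) := by
  rw [map_add, map_smul, smul_eq_mul, mul_sub, mul_div_cancel₀ _ (neg_ne_zero.2 hc)]
  ring

theorem visibleFacets_add_smul {c : W} (hc : ∀ G ∈ facets p N, facetNormal p N G c < 0) (x : W)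
    (t : ℝ) : visibleFacets p N (x + t • c) =
      {G ∈ facets p N | t < facetNormal p N G x / -facetNormal p N G c} := by
  ext G
  refine and_congr_right fun hG => ?_
  rw [dual_apply_add_smul (hc G hG).ne, mul_pos_iff_of_pos_left (neg_pos.2 (hc G hG)), sub_pos]

namespace GeneralPosition

variable {x : W}

theorem exists_generic_direction (h : GeneralPosition p N)
    (hx : ∀ G ∈ facets p N, facetNormal p N G x ≠ 0) :
    ∃ w : ι → ℝ, (∀ i ∈ N, 0 < w i) ∧ (facets p N).InjOn fun G =>
      facetNormal p N G x / -facetNormal p N G (∑ i ∈ N, w i • p i) := by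
  let ψ (G H : Finset ι) : Module.Dual ℝ W :=
    facetNormal p N G x • facetNormal p N H - facetNormal p N H x • facetNormal p N G
  have hfin : {χ | ∃ G ∈ facets p N, ∃ H ∈ facets p N, G ≠ H ∧ ψ G H = χ}.Finite := by
    have hN : (facets p N).Finite := finite_facets
    refine (hN.image2 ψ hN).subset ?_
    rintro _ ⟨G, hG, H, hH, -, rfl⟩
    exact ⟨G, hG, H, hH, rfl⟩
  obtain ⟨w, hw, hψw⟩ := exists_pos_weights (p := p) (N := N) hfin <| by
    rintro _ ⟨G, hG, H, hH, hGH, rfl⟩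
    obtain ⟨i, hiG, hiH⟩ := Finset.not_subset.1 fun hsub => hGH <|
      Finset.eq_of_subset_of_card_le hsub (by have := hG.1; have := hH.1; omega)
    have hn : Exposes p N G _ := exposes_facetNormal hG
    refine ⟨i, hn.subset hiG, ?_⟩
    simp only [ψ, LinearMap.sub_apply, LinearMap.smul_apply, hn.eq_zero i hiG, smul_zero, sub_zero]
    exact smul_ne_zero (hx G hG) ((exposes_facetNormal hH).neg i (hn.subset hiG) hiH).ne
  refine ⟨w, hw, fun G hG H hH heq => by_contra fun hGH => hψw _ ⟨G, hG, H, hH, hGH, rfl⟩ ?_⟩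
  have hGc := ((exposes_facetNormal hG).apply_sum_neg (h.ne_of_mem_facets hG) hw).ne
  have hHc := ((exposes_facetNormal hH).apply_sum_neg (h.ne_of_mem_facets hH) hw).ne
  dsimp only at heq
  rw [div_eq_div_iff (neg_ne_zero.2 hGc) (neg_ne_zero.2 hHc)] at heq
  simp only [ψ, LinearMap.sub_apply, LinearMap.smul_apply, smul_eq_mul]
  linear_combination -heq

variable [FiniteDimensional ℝ W] {F : Finset ι} {d k : ℕ}

theorem exists_hidden_facet_iff (h : GeneralPosition p N) (hF : F ∈ facets p N) {c : ι → ℝ}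
    (hx : facetNormal p N F (∑ a ∈ F, c a • p a) = 0)
    (hgen : ∀ G ∈ facets p N, G ≠ F → facetNormal p N G (∑ a ∈ F, c a • p a) ≠ 0) (hA : A ⊆ F) :
    (∃ H ∈ facets p N \ insert F (visibleFacets p N (∑ a ∈ F, c a • p a)), A ⊆ H) ↔
      ¬ {a ∈ F | 0 < c a} ⊆ A := by
  have hmirror := h.exists_visible_facet_iff hF (-c) hA
  simp only [Pi.neg_apply, neg_smul, Finset.sum_neg_distrib, neg_lt_zero] at hmirror
  rw [← hmirror]
  refine exists_congr fun H => and_congr_left fun _ => ⟨fun ⟨hH, hHF⟩ => ?_, fun ⟨hH, hlt⟩ => ?_⟩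
  · have hle := not_lt.1 fun hlt => hHF (Or.inr ⟨hH, hlt⟩)
    refine ⟨hH, ?_⟩
    rw [map_neg, neg_pos]
    exact hle.lt_of_ne (hgen H hH fun h => hHF (Or.inl h))
  · rw [map_neg, neg_pos] at hlt
    refine ⟨hH, ?_⟩
    rintro (rfl | hvis)
    exacts [hlt.ne hx, hlt.not_gt hvis.2]

/-- A viewpoint `x` crosses the hyperplane of the facet `F`. With `x = ∑ a ∈ F, c a • p a`, the move
is `α ↦ β` where `c` is positive on `α` and negative on `β`. -/
theorem bistellarStep_crossing [DecidableEq ι] (h : GeneralPosition p N)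
    (hW : Module.finrank ℝ W = d + 3) (hk : k ≤ d + 1) (hF : F ∈ facets p N)
    (hx : facetNormal p N F x = 0)
    (hgen : ∀ G ∈ facets p N, G ≠ F → facetNormal p N G x ≠ 0)
    (hvis : (visibleFacets p N x).Nonempty)
    (hexp : ∀ A ⊆ N, A.card + k ≤ d + 1 → ∃ φ, Exposes p N A φ ∧ φ x ≤ 0) :
    BistellarStep d k (separatingComplex (facets p N) (visibleFacets p N x))
      (separatingComplex (facets p N) (insert F (visibleFacets p N x))) := by
  have hcard : ∀ G ∈ facets p N, G.card = d + 2 := fun G hG => by have := hG.1; omega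
  have hFN := (exposes_facetNormal hF).subset
  obtain ⟨c, rfl⟩ := h.exists_sum_smul_of_facetNormal_eq_zero hF hx
  have hc := h.coeff_ne_zero hF hgen
  have hdisj : Disjoint {a ∈ F | 0 < c a} {a ∈ F | c a < 0} :=
    Finset.disjoint_filter.2 fun a _ ha => ha.not_gt
  have hunion : {a ∈ F | 0 < c a} ∪ {a ∈ F | c a < 0} = F := by
    rw [← Finset.filter_or, Finset.filter_true_of_mem fun a ha => (hc a ha).lt_or_gt.symm]
  have hsum := Finset.card_union_of_disjoint hdisj
  rw [hunion, hcard F hF] at hsum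
  have hβ : {a ∈ F | c a < 0}.Nonempty := by
    obtain ⟨G, hG⟩ := hvis
    have := (h.exists_visible_facet_iff hF c (Finset.empty_subset F)).1
      ⟨G, hG, Finset.empty_subset G⟩
    rwa [Finset.subset_empty, ← ne_eq, ← Finset.nonempty_iff_ne_empty] at this
  have hα : d + 1 < {a ∈ F | 0 < c a}.card + k := by
    by_contra! hle
    obtain ⟨φ, hφ, hφx⟩ := hexp _ ((Finset.filter_subset _ F).trans hFN) hle
    obtain ⟨b, hb⟩ := hβ
    exact hφx.not_gt (hφ.apply_sum_pos hFN (Finset.mem_filter.1 hb).1 (Finset.mem_filter.1 hb).2)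
  have hβ' := Finset.card_pos.2 hβ
  exact ⟨_, _, isBistellarMove_separatingComplex hcard (Set.sep_subset _ _) hF hdisj hunion
    (Finset.card_pos.1 (by omega)) hβ (fun _ => h.exists_visible_facet_iff hF c)
    (fun _ => h.exists_hidden_facet_iff hF hx hgen), by omega⟩

theorem separatingComplex_singleton (h : GeneralPosition p N) (hF : F ∈ facets p N) :
    separatingComplex (facets p N) {F} = simplexBoundary F := by
  classical
  ext A
  constructor
  · rintro ⟨hne, ⟨G, rfl, hAG⟩, H, ⟨hH, hHG⟩, hAH⟩
    refine ⟨hne, hAG.ssubset_of_ne ?_⟩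
    rintro rfl
    exact hHG (Finset.eq_of_subset_of_card_le hAH (by have := hF.1; have := hH.1; omega)).symm
  · rintro ⟨hne, hAF⟩
    obtain ⟨a, ha, haA⟩ := Finset.exists_of_ssubset hAF
    obtain ⟨G, hG, hFG, haG⟩ := h.exists_adjacent_facet hF ha
    exact ⟨hne, ⟨F, rfl, hAF.subset⟩, G, ⟨hG, fun hGF => haG (hGF ▸ ha)⟩,
      (Finset.subset_erase.2 ⟨hAF.subset, haA⟩).trans hFG⟩

theorem exists_reflTransGen_separatingComplex [DecidableEq ι] (h : GeneralPosition p N)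
    (hW : Module.finrank ℝ W = d + 3) (hk : k ≤ d + 1)
    (hx : ∀ G ∈ facets p N, facetNormal p N G x ≠ 0) (hvis : (visibleFacets p N x).Nonempty)
    (hexp : ∀ A ⊆ N, A.card + k ≤ d + 1 → ∃ φ, Exposes p N A φ ∧ φ x ≤ 0) :
    ∃ F ∈ facets p N, Relation.ReflTransGen (BistellarStep d k) (simplexBoundary F)
      (separatingComplex (facets p N) (visibleFacets p N x)) := by
  obtain ⟨w, hw, hinj⟩ := h.exists_generic_direction hx
  set c := ∑ i ∈ N, w i • p i
  have hc : ∀ G ∈ facets p N, facetNormal p N G c < 0 := fun G hG =>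
    (exposes_facetNormal hG).apply_sum_neg (h.ne_of_mem_facets hG) hw
  -- The moving viewpoint `x + t • c` crosses the hyperplane of `G` at the time `τ G`.
  set τ : Finset ι → ℝ := fun G => facetNormal p N G x / -facetNormal p N G c
  have hτ : ∀ G ∈ facets p N, ∀ t : ℝ,
      facetNormal p N G (x + t • c) = -facetNormal p N G c * (τ G - t) := fun G hG =>
    dual_apply_add_smul (hc G hG).ne
  have hvisible (t : ℝ) : {G ∈ facets p N | t < τ G} = visibleFacets p N (x + t • c) :=
    (visibleFacets_add_smul hc x t).symm
  have hvis₀ : {G ∈ facets p N | 0 < τ G} = visibleFacets p N x := by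
    rw [hvisible, zero_smul, add_zero]
  have hstep : ∀ F ∈ facets p N, 0 < τ F → {G ∈ facets p N | τ F < τ G}.Nonempty →
      BistellarStep d k (separatingComplex (facets p N) {G ∈ facets p N | τ F < τ G})
        (separatingComplex (facets p N) (insert F {G ∈ facets p N | τ F < τ G})) := by
    intro F hF hpos hne
    rw [hvisible] at hne ⊢
    refine h.bistellarStep_crossing hW hk hF ?_ (fun G hG hGF => ?_) hne fun A hA hcard => ?_
    · rw [hτ F hF, sub_self, mul_zero]
    · rw [hτ G hG]
      exact mul_ne_zero (neg_ne_zero.2 (hc G hG).ne) (sub_ne_zero.2 fun heq => hGF (hinj hG hF heq))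
    · obtain ⟨φ, hφ, hφx⟩ := hexp A hA hcard
      refine ⟨φ, hφ, ?_⟩
      rw [map_add, map_smul]
      exact add_nonpos hφx (mul_nonpos_of_nonneg_of_nonpos hpos.le (hφ.apply_sum_nonpos hw))
  obtain ⟨F, hF, hreach⟩ := reflTransGen_of_sweep finite_facets hinj
    (R := fun 𝓥 𝓥' => BistellarStep d k (separatingComplex (facets p N) 𝓥)
      (separatingComplex (facets p N) 𝓥')) hstep (hvis₀ ▸ hvis)
  refine ⟨F, hF, ?_⟩
  rw [← h.separatingComplex_singleton hF, ← hvis₀]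
  exact hreach.lift _ fun _ _ => id

end GeneralPosition

end Sweep

section FacetComplex

open PreAbstractSimplicialComplex

variable {ι W : Type*} [AddCommGroup W] [Module ℝ W]

/-- The complex generated by the facets of the configuration `p` on `N`, assumed to be in general
position: the boundary complex of the convex hull. -/
def facetComplex (p : ι → W) (N : Finset ι) : PreAbstractSimplicialComplex ι where
  faces := {A | A.Nonempty ∧ ∃ F ∈ facets p N, A ⊆ F}
  isRelLowerSet_faces := fun _ ⟨hne, F, hF, hAF⟩ =>
    ⟨hne, fun _ hB hBne => ⟨hBne, F, hF, hB.trans hAF⟩⟩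

variable {p : ι → W} {N F H : Finset ι} {d k : ℕ} {v : ι}

theorem facetComplex_hasDim (hW : Module.finrank ℝ W = d + 2) (hne : (facets p N).Nonempty) :
    (facetComplex p N).HasDim d := by
  have hcard : ∀ F ∈ facets p N, F.card = d + 1 := fun F hF => by have := hF.1; omega
  refine ⟨fun A ⟨_, F, hF, hAF⟩ => (Finset.card_le_card hAF).trans_eq (hcard F hF), ?_⟩
  obtain ⟨F, hF⟩ := hne
  exact ⟨F, ⟨Finset.card_pos.1 (by rw [hcard F hF]; omega), F, hF, subset_rfl⟩, hcard F hF⟩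

theorem link_simplexBoundary [DecidableEq ι] (hv : v ∈ N) :
    (simplexBoundary N).link v = simplexBoundary (N.erase v) := by
  ext A
  constructor
  · rintro ⟨hne, hvA, -, hAN⟩
    exact ⟨hne, by grind⟩
  · rintro ⟨hne, hAN⟩
    have hvA : v ∉ A := fun h => Finset.notMem_erase v N (hAN.subset h)
    exact ⟨hne, hvA, Finset.insert_nonempty v A, by grind⟩

namespace GeneralPosition

theorem facetComplex_eq_simplexBoundary (h : GeneralPosition p N)
    (hN : N.card = Module.finrank ℝ W) : facetComplex p N = simplexBoundary N := by
  classical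
  ext A
  constructor
  · rintro ⟨hne, F, hF, hAF⟩
    exact ⟨hne, hAF.trans_ssubset
      ((exposes_facetNormal hF).subset.ssubset_of_ne (h.ne_of_mem_facets hF))⟩
  · rintro ⟨hne, hAN⟩
    obtain ⟨a, ha, haA⟩ := Finset.exists_of_ssubset hAN
    obtain ⟨φ, hφ⟩ := h.exists_dual_eq subset_rfl hN.le (Pi.single a (-1))
    refine ⟨hne, N.erase a, ⟨by rw [Finset.card_erase_add_one ha, hN], φ,
      Finset.erase_subset a N, fun i hi => ?_, fun i hi hia => ?_⟩,
      Finset.subset_erase.2 ⟨hAN.subset, haA⟩⟩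
    · rw [hφ i (Finset.mem_of_mem_erase hi), Pi.single_eq_of_ne (Finset.ne_of_mem_erase hi)]
    · have hia' : i = a := by simpa [hi] using hia
      rw [hφ i hi, hia', Pi.single_eq_same]
      exact neg_one_lt_zero

variable [DecidableEq ι] [FiniteDimensional ℝ W]

theorem facetNormal_erase_apply_ne_zero (h : GeneralPosition p N)
    (hN : Module.finrank ℝ W < N.card) (hv : v ∈ N) (hH : H ∈ facets p (N.erase v)) :
    facetNormal p (N.erase v) H (p v) ≠ 0 := by
  intro hzero
  have hn := exposes_facetNormal hH
  obtain ⟨i, -, -, hi⟩ := hn.exists_neg ((h.erase hN v).ne_of_mem_facets hH)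
  have hne : facetNormal p (N.erase v) H ≠ 0 := fun h0 => by simp [h0] at hi
  have hlt := h.card_lt_finrank
    (Finset.insert_subset hv (hn.subset.trans (Finset.erase_subset v N))) hne
    (Finset.forall_mem_insert .. |>.2 ⟨hzero, hn.eq_zero⟩)
  rw [Finset.card_insert_of_notMem fun h => Finset.notMem_erase v N (hn.subset h), hH.1] at hlt
  exact lt_irrefl _ hlt

theorem exists_visible_facet_erase (h : GeneralPosition p N) (hN : Module.finrank ℝ W < N.card)
    (hF : F ∈ facets p N) (hv : v ∈ F) :
    ∃ G ∈ visibleFacets p (N.erase v) (p v), F.erase v ⊆ G := by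
  obtain ⟨G, ψ, hFG, hG, hψ, hψv⟩ := h.exists_facet_erase hF hv one_ne_zero
  obtain ⟨t, ht, rfl⟩ := (h.erase hN v).exists_eq_smul_facetNormal hG hψ
  refine ⟨G, ⟨⟨hG, _, hψ⟩, pos_of_mul_pos_right (a := t) ?_ ht.le⟩, hFG⟩
  exact one_pos.trans_eq hψv.symm

theorem exists_hidden_facet_erase (h : GeneralPosition p N) (hN : Module.finrank ℝ W < N.card)
    (hF : F ∈ facets p N) (hv : v ∈ F) :
    ∃ H ∈ facets p (N.erase v) \ visibleFacets p (N.erase v) (p v), F.erase v ⊆ H := by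
  obtain ⟨H, ψ, hFH, hH, hψ, hψv⟩ := h.exists_facet_erase hF hv (neg_ne_zero.2 one_ne_zero)
  obtain ⟨t, ht, rfl⟩ := (h.erase hN v).exists_eq_smul_facetNormal hH hψ
  refine ⟨H, ⟨⟨hH, _, hψ⟩, fun hvis => (mul_pos ht hvis.2).not_ge ?_⟩, hFH⟩
  exact hψv.trans_le (neg_nonpos.2 zero_le_one)

/-- The hyperplanes of a visible and of a hidden facet of `N.erase v` span a pencil containing a
supporting hyperplane of `N` through `p v`. -/
theorem exists_facet_of_subset_inter (h : GeneralPosition p N) (hN : Module.finrank ℝ W < N.card)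
    (hv : v ∈ N) {A G : Finset ι} (hG : G ∈ visibleFacets p (N.erase v) (p v))
    (hH : H ∈ facets p (N.erase v) \ visibleFacets p (N.erase v) (p v)) (hAG : A ⊆ G)
    (hAH : A ⊆ H) : ∃ F ∈ facets p N, insert v A ⊆ F := by
  have hnG := exposes_facetNormal hG.1
  have hnH := exposes_facetNormal hH.1
  have hposG := hG.2
  have hnegH : facetNormal p (N.erase v) H (p v) < 0 :=
    (not_lt.1 fun hpos => hH.2 ⟨hH.1, hpos⟩).lt_of_ne
      (h.facetNormal_erase_apply_ne_zero hN hv hH.1)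
  set nG := facetNormal p (N.erase v) G
  set nH := facetNormal p (N.erase v) H
  set χ : Module.Dual ℝ W := -nH (p v) • nG + nG (p v) • nH with hχ
  have hχv : χ (p v) = 0 := by
    simp only [χ, LinearMap.add_apply, LinearMap.smul_apply, smul_eq_mul]
    ring
  have hχ_nonpos : ∀ i ∈ N.erase v, χ (p i) ≤ -nH (p v) * nG (p i) := fun i hi => by
    simpa [χ] using mul_nonpos_of_nonneg_of_nonpos hposG.le (hnH.nonpos i hi)
  have hexp : Exposes p N {i ∈ N | χ (p i) = 0} χ := exposes_filter_of_nonpos fun i hi => by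
    rcases eq_or_ne i v with rfl | hiv
    · exact hχv.le
    · have hi' := Finset.mem_erase.2 ⟨hiv, hi⟩
      exact (hχ_nonpos i hi').trans
        (mul_nonpos_of_nonneg_of_nonpos (neg_pos.2 hnegH).le (hnG.nonpos i hi'))
  obtain ⟨i, hi, -, hneg⟩ := hnG.exists_neg ((h.erase hN v).ne_of_mem_facets hG.1)
  have hne : ({i ∈ N | χ (p i) = 0} : Finset ι) ≠ N := fun heq => by
    have hi0 := (Finset.filter_eq_self.1 heq) i (Finset.mem_of_mem_erase hi)
    exact ((hχ_nonpos i hi).trans_lt (mul_neg_of_pos_of_neg (neg_pos.2 hnegH) hneg)).ne hi0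
  obtain ⟨F, hF, hsub⟩ := h.exists_facet hexp hne
  refine ⟨F, hF, (Finset.insert_subset (by simp [hv, hχv]) fun a ha => ?_).trans hsub⟩
  refine Finset.mem_filter.2 ⟨Finset.mem_of_mem_erase (hnG.subset (hAG ha)), ?_⟩
  simp [χ, hnG.eq_zero a (hAG ha), hnH.eq_zero a (hAH ha)]

theorem link_facetComplex (h : GeneralPosition p N) (hN : Module.finrank ℝ W < N.card)
    (hv : v ∈ N) : (facetComplex p N).link v =
      separatingComplex (facets p (N.erase v)) (visibleFacets p (N.erase v) (p v)) := by
  ext A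
  constructor
  · rintro ⟨hne, hvA, -, F, hF, hAF⟩
    have hvF := hAF (Finset.mem_insert_self v A)
    have hAF' : A ⊆ F.erase v :=
      Finset.subset_erase.2 ⟨(Finset.subset_insert v A).trans hAF, hvA⟩
    obtain ⟨G, hG, hFG⟩ := h.exists_visible_facet_erase hN hF hvF
    obtain ⟨H, hH, hFH⟩ := h.exists_hidden_facet_erase hN hF hvF
    exact ⟨hne, ⟨G, hG, hAF'.trans hFG⟩, H, hH, hAF'.trans hFH⟩
  · rintro ⟨hne, ⟨G, hG, hAG⟩, H, hH, hAH⟩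
    have hvA : v ∉ A := fun hvA =>
      Finset.notMem_erase v N ((exposes_facetNormal hG.1).subset (hAG hvA))
    exact ⟨hne, hvA, Finset.insert_nonempty v A,
      h.exists_facet_of_subset_inter hN hv hG hH hAG hAH⟩

theorem exists_reflTransGen_link (h : GeneralPosition p N) (hW : Module.finrank ℝ W = d + 3)
    (hk : k ≤ d + 1) (hv : {v} ∈ (facetComplex p N).faces)
    (hexp : ∀ A ⊆ N, A.card + k ≤ d + 1 → ∃ φ, Exposes p N A φ) :
    ∃ σ : Finset ι, σ.card = d + 2 ∧ Relation.ReflTransGen (BistellarStep d k)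
      (simplexBoundary σ) ((facetComplex p N).link v) := by
  obtain ⟨-, F, hF, hvF⟩ := hv
  rw [Finset.singleton_subset_iff] at hvF
  have hvN := (exposes_facetNormal hF).subset hvF
  rcases h.finrank_le_card.eq_or_lt with hN | hN
  · refine ⟨N.erase v, by rw [Finset.card_erase_of_mem hvN]; omega, ?_⟩
    rw [h.facetComplex_eq_simplexBoundary hN.symm, link_simplexBoundary hvN]
  · obtain ⟨G, hG, -⟩ := h.exists_visible_facet_erase hN hF hvF
    have hexp' : ∀ A ⊆ N.erase v, A.card + k ≤ d + 1 →
        ∃ φ, Exposes p (N.erase v) A φ ∧ φ (p v) ≤ 0 := fun A hA hcard => by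
      obtain ⟨φ, hφ⟩ := hexp A (hA.trans (Finset.erase_subset v N)) hcard
      refine ⟨φ, ?_, hφ.nonpos v hvN⟩
      rw [← Finset.erase_eq_of_notMem fun hvA => Finset.notMem_erase v N (hA hvA)]
      exact hφ.erase v
    obtain ⟨σ, hσ, hreach⟩ := (h.erase hN v).exists_reflTransGen_separatingComplex hW hk
      (fun _ => h.facetNormal_erase_apply_ne_zero hN hvN) ⟨G, hG⟩ hexp'
    exact ⟨σ, by have := hσ.1; omega, h.link_facetComplex hN hvN ▸ hreach⟩

end GeneralPosition

end FacetComplex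

section Connected

open PreAbstractSimplicialComplex

variable {ι W : Type*} [AddCommGroup W] [Module ℝ W] [FiniteDimensional ℝ W]
  {p : ι → W} {N : Finset ι}

namespace GeneralPosition

theorem singleton_mem_facetComplex (h : GeneralPosition p N) (hW : 2 ≤ Module.finrank ℝ W) {v : ι}
    {φ : Module.Dual ℝ W} (hφ : Exposes p N {v} φ) : {v} ∈ (facetComplex p N).faces := by
  refine ⟨Finset.singleton_nonempty v, h.exists_facet hφ ?_⟩
  rintro rfl
  have := h.finrank_le_card
  rw [Finset.card_singleton] at this
  omega

variable [DecidableEq ι]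

theorem exists_edge_of_ssubset (h : GeneralPosition p N) (hW : 3 ≤ Module.finrank ℝ W) {v : ι}
    {F : Finset ι} {φ ψ : Module.Dual ℝ W} (hφ : Exposes p N {v} φ) (hF : Exposes p N F ψ)
    (hvF : {v} ⊂ F) : ∃ b ∈ F, b ≠ v ∧ {v, b} ∈ (facetComplex p N).faces := by
  obtain ⟨G, hG, hvG, b, hbG, hbF, hbv⟩ :
      ∃ G ∈ facets p N, {v} ⊆ G ∧ ∃ b ∈ G, b ∈ F ∧ b ≠ v := by
    rcases eq_or_ne F N with rfl | hFN
    · obtain ⟨-, G, hG, hvG⟩ := h.singleton_mem_facetComplex (by omega) hφ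
      obtain ⟨b, hb, hbv⟩ := Finset.exists_mem_ne (s := G) (by have := hG.1; omega) v
      exact ⟨G, hG, hvG, b, hb, (exposes_facetNormal hG).subset hb, hbv⟩
    · obtain ⟨G, hG, hFG⟩ := h.exists_facet hF hFN
      obtain ⟨b, hb, hbv⟩ := Finset.exists_of_ssubset hvF
      exact ⟨G, hG, hvF.1.trans hFG, b, hFG hb, hb, Finset.notMem_singleton.1 hbv⟩
  exact ⟨b, hbF, hbv, Finset.insert_nonempty v _, G, hG, Finset.insert_subset
    (Finset.singleton_subset_iff.1 hvG) (Finset.singleton_subset_iff.2 hbG)⟩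

/-- A step of the simplex method for the objective `-g / χ`: from a vertex `v` that is not optimal,
pivoting leads to a better vertex `b` along an edge. -/
theorem exists_improving_edge (h : GeneralPosition p N) (hW : 3 ≤ Module.finrank ℝ W) {v m : ι}
    {φ g χ : Module.Dual ℝ W} (hφ : Exposes p N {v} φ) (hg : Exposes p N {m} g)
    (hχ : Exposes p N ∅ χ) (hvm : v ≠ m) :
    ∃ b ∈ N, b ≠ v ∧ {v, b} ∈ (facetComplex p N).faces ∧
      g (p b) / χ (p b) < g (p v) / χ (p v) := by
  have hv := hφ.subset (Finset.mem_singleton_self v)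
  have hm := hg.subset (Finset.mem_singleton_self m)
  have hχ_neg : ∀ i ∈ N, χ (p i) < 0 := fun i hi => hχ.neg i hi (Finset.notMem_empty i)
  have hφ_neg : ∀ i ∈ N, i ≠ v → φ (p i) < 0 := fun i hi hiv =>
    hφ.neg i hi (Finset.notMem_singleton.2 hiv)
  set r := g (p v) / χ (p v) with hr
  have hr_pos : 0 < r :=
    div_pos_of_neg_of_neg (hg.neg v hv (Finset.notMem_singleton.2 hvm)) (hχ_neg v hv)
  have hval (i : ι) (s : ℝ) :
      (g - r • χ + s • φ) (p i) = g (p i) - r * χ (p i) + s * φ (p i) := by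
    simp
  have hvN : ({v} : Finset ι) ≠ N := fun heq => by simp [← heq, hvm.symm] at hm
  obtain ⟨s, F, hvF, hF⟩ := hφ.exists_pivot (ψ := g - r • χ) hvN fun i hi => by
    rw [Finset.mem_singleton.1 hi, LinearMap.sub_apply, LinearMap.smul_apply, smul_eq_mul, hr,
      div_mul_cancel₀ _ (hχ_neg v hv).ne, sub_self]
  have hs : 0 < s := by
    have hle := hF.nonpos m hm
    rw [hval, hg.eq_zero m (Finset.mem_singleton_self m)] at hle
    have := mul_neg_of_pos_of_neg hr_pos (hχ_neg m hm)
    exact pos_of_mul_neg_left (by linarith) (hφ_neg m hm hvm.symm).le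
  have himprove : ∀ b ∈ F, b ≠ v → g (p b) / χ (p b) < r := fun b hb hbv => by
    have hbN := hF.subset hb
    have h0 := hF.eq_zero b hb
    rw [hval] at h0
    have := mul_neg_of_pos_of_neg hs (hφ_neg b hbN hbv)
    rw [div_lt_iff_of_neg (hχ_neg b hbN)]
    linarith
  obtain ⟨b, hbF, hbv, hedge⟩ := h.exists_edge_of_ssubset hW hφ hF hvF
  exact ⟨b, hF.subset hbF, hbv, hedge, himprove b hbF hbv⟩

theorem isConnected_facetComplex (h : GeneralPosition p N) (hW : 3 ≤ Module.finrank ℝ W)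
    (hexp : ∀ A ⊆ N, A.card ≤ 1 → ∃ φ, Exposes p N A φ) : (facetComplex p N).IsConnected := by
  have hvert : ∀ v ∈ N, ∃ φ, Exposes p N {v} φ := fun v hv =>
    hexp {v} (Finset.singleton_subset_iff.2 hv) (Finset.card_singleton v).le
  have hmem : ∀ v ∈ N, {v} ∈ (facetComplex p N).faces := fun v hv =>
    h.singleton_mem_facetComplex (by omega) (hvert v hv).choose_spec
  obtain ⟨m, hm⟩ : N.Nonempty := Finset.card_pos.1 (by have := h.finrank_le_card; omega)
  obtain ⟨g, hg⟩ := hvert m hm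
  obtain ⟨χ, hχ⟩ := hexp ∅ (Finset.empty_subset N) (by simp)
  have hreach : ∀ v (hv : v ∈ N),
      (facetComplex p N).edgeGraph.Reachable ⟨v, hmem v hv⟩ ⟨m, hmem m hm⟩ := by
    by_contra! hne
    obtain ⟨⟨v, hv⟩, hvr, hmin⟩ := Set.exists_min_image
      {v : N | ¬ (facetComplex p N).edgeGraph.Reachable ⟨v, hmem v v.2⟩ ⟨m, hmem m hm⟩}
      (fun v => g (p v) / χ (p v)) (Set.toFinite _) (by simpa [Set.Nonempty] using hne)
    have hvm : v ≠ m := by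
      rintro rfl
      exact hvr (SimpleGraph.Reachable.refl _)
    obtain ⟨φ, hφ⟩ := hvert v hv
    obtain ⟨b, hb, hbv, hedge, hlt⟩ := h.exists_improving_edge hW hφ hg hχ hvm
    have hadj : (facetComplex p N).edgeGraph.Adj ⟨v, hmem v hv⟩ ⟨b, hmem b hb⟩ :=
      ⟨fun heq => hbv (congrArg Subtype.val heq).symm, hedge⟩
    have hbr : ¬ (facetComplex p N).edgeGraph.Reachable ⟨b, hmem b hb⟩ ⟨m, hmem m hm⟩ :=
      fun hbr => hvr (hadj.reachable.trans hbr)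
    exact hlt.not_ge (hmin ⟨b, hb⟩ hbr)
  have hN (u : {v : ι // {v} ∈ (facetComplex p N).faces}) : (u : ι) ∈ N := by
    obtain ⟨-, F, hF, huF⟩ := u.2
    exact (exposes_facetNormal hF).subset (Finset.singleton_subset_iff.1 huF)
  have : Nonempty {v : ι // {v} ∈ (facetComplex p N).faces} := ⟨⟨m, hmem m hm⟩⟩
  exact ⟨fun u v => (hreach u (hN u)).trans (hreach v (hN v)).symm⟩

end GeneralPosition

end Connected

section FaceIsomorphism

open PreAbstractSimplicialComplex

theorem FaceIsomorphic.refl {V : Type*} (F : Set (Finset V)) : FaceIsomorphic F F :=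
  ⟨id, Set.injOn_id _, by simp⟩

theorem FaceIsomorphic.trans {U V W : Type*} {F : Set (Finset U)} {G : Set (Finset V)}
    {H : Set (Finset W)} (hFG : FaceIsomorphic F G) (hGH : FaceIsomorphic G H) :
    FaceIsomorphic F H := by
  classical
  obtain ⟨f, hf, hfG⟩ := hFG
  obtain ⟨g, hg, hgH⟩ := hGH
  have himage : ∀ A ∈ F, A.image f ∈ G := fun A hA => (hfG _).2 ⟨A, hA, Finset.coe_image⟩
  refine ⟨g ∘ f, hg.comp hf ?_, fun C => (hgH C).trans ⟨?_, ?_⟩⟩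
  · rintro v ⟨A, hA, hv⟩
    exact ⟨A.image f, himage A hA, Finset.mem_image_of_mem f hv⟩
  · rintro ⟨B, hB, hBC⟩
    obtain ⟨A, hA, hAB⟩ := (hfG B).1 hB
    exact ⟨A, hA, by rw [hBC, hAB, Set.image_comp]⟩
  · rintro ⟨A, hA, hAC⟩
    exact ⟨A.image f, himage A hA, by rw [hAC, Finset.coe_image, Set.image_comp]⟩

theorem FaceIsomorphic.isStellated {V W : Type*} {X : PreAbstractSimplicialComplex V}
    {Y : PreAbstractSimplicialComplex W} {k d : ℕ} (h : FaceIsomorphic X.faces Y.faces)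
    (hY : Y.IsStellated k d) : X.IsStellated k d := by
  obtain ⟨σ, Z, hσ, hZ, hYZ⟩ := hY
  exact ⟨σ, Z, hσ, hZ, h.trans hYZ⟩

variable {V W : Type*} [DecidableEq W] {S : PreAbstractSimplicialComplex V} {f : V → W}
  {A : Finset V} {B : Finset W} {v : V} {d k l : ℕ}

theorem singleton_mem_faces (hA : A ∈ S.faces) (hv : v ∈ A) : {v} ∈ S.faces :=
  (S.isRelLowerSet_faces hA).2 (Finset.singleton_subset_iff.2 hv) (Finset.singleton_nonempty v)

theorem FaceIsomorphic.exists_map {G : Set (Finset W)} (h : FaceIsomorphic S.faces G) :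
    ∃ f : V → W, Set.InjOn f {v | {v} ∈ S.faces} ∧ (S.map f).faces = G := by
  obtain ⟨f, hf, hfG⟩ := h
  have hvert : {v | {v} ∈ S.faces} ⊆ {v | ∃ A ∈ S.faces, v ∈ A} := fun v hv =>
    ⟨{v}, hv, Finset.mem_singleton_self v⟩
  refine ⟨f, hf.mono hvert, ?_⟩
  ext B
  rw [hfG B]
  refine exists_congr fun A => and_congr_right fun _ => ?_
  rw [← Finset.coe_image, Finset.coe_inj, eq_comm]

theorem exists_image_eq_of_forall_singleton_mem (hB : ∀ w ∈ B, {w} ∈ (S.map f).faces) :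
    ∃ A : Finset V, (∀ v ∈ A, {v} ∈ S.faces) ∧ A.image f = B := by
  have hBf : (B : Set W) ⊆ f '' {v | {v} ∈ S.faces} := fun w hw => by
    obtain ⟨A, hA, hAw⟩ := hB w hw
    obtain ⟨v, hv, rfl⟩ := Finset.mem_image.1 (hAw.superset (Finset.mem_singleton_self w))
    exact ⟨v, singleton_mem_faces hA hv, rfl⟩
  exact Finset.subset_set_image_iff.1 hBf

theorem isNeighbourly_map (hf : Set.InjOn f {v | {v} ∈ S.faces}) (h : S.IsNeighbourly l) :
    (S.map f).IsNeighbourly l := by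
  intro B hne hB hcard
  obtain ⟨A, hA, rfl⟩ := exists_image_eq_of_forall_singleton_mem hB
  rw [Finset.card_image_of_injOn (hf.mono hA)] at hcard
  exact ⟨A, h A (Finset.image_nonempty.1 hne) hA hcard, rfl⟩

theorem injOn_image_of_injOn_vertices (hf : Set.InjOn f {v | {v} ∈ S.faces}) :
    Set.InjOn (Finset.image f) {A | ∀ v ∈ A, {v} ∈ S.faces} := by
  intro A hA A' hA' heq
  have himage : f '' A = f '' A' := by rw [← Finset.coe_image, heq, Finset.coe_image]
  exact Finset.coe_injective ((hf.image_eq_image_iff hA hA').1 himage)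

theorem image_mem_map_faces_iff (hf : Set.InjOn f {v | {v} ∈ S.faces})
    (hA : ∀ v ∈ A, {v} ∈ S.faces) : A.image f ∈ (S.map f).faces ↔ A ∈ S.faces :=
  (injOn_image_of_injOn_vertices hf).mem_image_iff
    (fun _ hA' _ hv => singleton_mem_faces hA' hv) hA

theorem finite_of_map (hf : Set.InjOn f {v | {v} ∈ S.faces}) (h : (S.map f).faces.Finite) :
    S.faces.Finite := by
  have hsub : S.faces ⊆ {A | ∀ v ∈ A, {v} ∈ S.faces} := fun A hA _ hv => singleton_mem_faces hA hv
  exact Set.Finite.of_finite_image h ((injOn_image_of_injOn_vertices hf).mono hsub)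

theorem hasDim_of_map (hf : Set.InjOn f {v | {v} ∈ S.faces}) (h : (S.map f).HasDim d) :
    S.HasDim d := by
  have hcard : ∀ A ∈ S.faces, (A.image f).card = A.card := fun A hA =>
    Finset.card_image_of_injOn (hf.mono fun _ hv => singleton_mem_faces hA hv)
  obtain ⟨hle, _, ⟨A, hA, rfl⟩, heq⟩ := h
  exact ⟨fun B hB => (hcard B hB).symm.trans_le (hle _ ⟨B, hB, rfl⟩),
    A, hA, (hcard A hA).symm.trans heq⟩

variable [DecidableEq V]

theorem isConnected_of_map (hf : Set.InjOn f {v | {v} ∈ S.faces}) (h : (S.map f).IsConnected) :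
    S.IsConnected := by
  let ψ (v : {v : V // {v} ∈ S.faces}) : {w : W // {w} ∈ (S.map f).faces} :=
    ⟨f v, {(v : V)}, v.2, Finset.image_singleton f v⟩
  have hinj : Function.Injective ψ := fun u v huv =>
    Subtype.ext (hf u.2 v.2 (congrArg Subtype.val huv))
  have hsurj : Function.Surjective ψ := by
    rintro ⟨w, A, hA, hAw⟩
    obtain ⟨v, hv, rfl⟩ := Finset.mem_image.1 (hAw.superset (Finset.mem_singleton_self w))
    exact ⟨⟨v, singleton_mem_faces hA hv⟩, rfl⟩
  let e : S.edgeGraph ≃g (S.map f).edgeGraph :=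
    { Equiv.ofBijective ψ ⟨hinj, hsurj⟩ with
      map_rel_iff' := fun {u v} => by
        refine and_congr hinj.ne_iff ?_
        change {f u, f v} ∈ (S.map f).faces ↔ _
        rw [← Finset.image_singleton, ← Finset.image_insert, image_mem_map_faces_iff hf]
        simp [u.2, v.2] }
  exact e.connected_iff.2 h

theorem image_mem_link_map_iff (hf : Set.InjOn f {v | {v} ∈ S.faces})
    (hA : ∀ u ∈ A, {u} ∈ S.faces) (hv : {v} ∈ S.faces) :
    A.image f ∈ ((S.map f).link (f v)).faces ↔ A ∈ (S.link v).faces := by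
  refine and_congr Finset.image_nonempty (and_congr (not_congr ?_) ?_)
  · rw [← Finset.mem_coe, Finset.coe_image, hf.mem_image_iff hA hv, Finset.mem_coe]
  · rw [← Finset.image_insert,
      image_mem_map_faces_iff hf (Finset.forall_mem_insert .. |>.2 ⟨hv, hA⟩)]

theorem faceIsomorphic_link_map (hf : Set.InjOn f {v | {v} ∈ S.faces}) (hv : {v} ∈ S.faces) :
    FaceIsomorphic (S.link v).faces ((S.map f).link (f v)).faces := by
  have hvert : ∀ A ∈ (S.link v).faces, ∀ u ∈ A, {u} ∈ S.faces := fun A hA u hu =>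
    singleton_mem_faces hA.2.2 (Finset.mem_insert_of_mem hu)
  refine ⟨f, hf.mono fun u ⟨A, hA, hu⟩ => hvert A hA u hu, fun B => ⟨fun hB => ?_, ?_⟩⟩
  · obtain ⟨A, hA, rfl⟩ := exists_image_eq_of_forall_singleton_mem (S := S) fun w hw =>
      singleton_mem_faces hB.2.2 (Finset.mem_insert_of_mem hw)
    exact ⟨A, (image_mem_link_map_iff hf hA hv).1 hB, Finset.coe_image⟩
  · rintro ⟨A, hA, hAB⟩
    rw [← Finset.coe_image, Finset.coe_inj] at hAB
    exact hAB ▸ (image_mem_link_map_iff hf (hvert A hA) hv).2 hA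

theorem memW_of_map (hf : Set.InjOn f {v | {v} ∈ S.faces}) (h : (S.map f).MemW k d) :
    S.MemW k d where
  one_le_dim := h.one_le_dim
  finite := finite_of_map hf h.finite
  connected := isConnected_of_map hf h.connected
  dim := hasDim_of_map hf h.dim
  link_stellated v hv := (faceIsomorphic_link_map hf hv).isStellated
    (h.link_stellated (f v) ⟨{v}, hv, Finset.image_singleton f v⟩)

end FaceIsomorphism

section ExposedFaces

open PreAbstractSimplicialComplex

variable {ι W : Type*} [AddCommGroup W] [Module ℝ W] {p : ι → W} {N : Finset ι}

/-- The proper faces of the configuration `p` on `N`, which for points in convex position are the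
proper faces of their convex hull. The whole set `N` is excluded separately, since it is exposed by
the functional `0`. -/
def exposedFaces (p : ι → W) (N : Finset ι) : Set (Finset ι) :=
  {A | A.Nonempty ∧ A ≠ N ∧ ∃ φ, Exposes p N A φ}

theorem exists_exposes_of_isNeighbourly {Y : PreAbstractSimplicialComplex ι} {l : ℕ}
    (hY : Y.faces = exposedFaces p N) (hn : Y.IsNeighbourly l) (hN : l ≤ N.card)
    (h₀ : ∃ φ, Exposes p N ∅ φ) (h₁ : ∀ i ∈ N, {i} ∈ exposedFaces p N) :
    ∀ A ⊆ N, A.card ≤ l → ∃ φ, Exposes p N A φ := by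
  intro A hA hcard
  rcases A.eq_empty_or_nonempty with rfl | hne
  · exact h₀
  · obtain ⟨B, hAB, hBN, hB⟩ := Finset.exists_subsuperset_card_eq hA hcard hN
    have hBY := hn B (hne.mono hAB) (fun i hi => hY ▸ h₁ i (hBN hi)) hB
    have hAY := (Y.isRelLowerSet_faces hBY).2 hAB hne
    rw [hY] at hAY
    exact hAY.2.2

theorem GeneralPosition.eq_facetComplex [FiniteDimensional ℝ W] (h : GeneralPosition p N)
    {Y : PreAbstractSimplicialComplex ι}
    (hY : Y.faces = exposedFaces p N) : Y = facetComplex p N := by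
  ext A
  constructor
  · intro hA
    obtain ⟨hne, hAN, φ, hφ⟩ := hY.subset hA
    exact ⟨hne, h.exists_facet hφ hAN⟩
  · rintro ⟨hne, F, hF, hAF⟩
    have hFY : F ∈ Y.faces := hY.superset
      ⟨hne.mono hAF, h.ne_of_mem_facets hF, _, exposes_facetNormal hF⟩
    exact (Y.isRelLowerSet_faces hFY).2 hAF hne

theorem GeneralPosition.memW_facetComplex [FiniteDimensional ℝ W] {p : ℕ → W} {N : Finset ℕ}
    {k : ℕ} (h : GeneralPosition p N) (hW : Module.finrank ℝ W = 2 * k + 3)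
    (hexp : ∀ A ⊆ N, A.card ≤ k + 1 → ∃ φ, Exposes p N A φ) :
    (facetComplex p N).MemW k (2 * k + 1) where
  one_le_dim := by omega
  finite := N.powerset.finite_toSet.subset fun A ⟨_, F, hF, hAF⟩ =>
    Finset.mem_powerset.2 (hAF.trans (exposes_facetNormal hF).subset)
  connected := h.isConnected_facetComplex (by omega) fun A hA hcard =>
    hexp A hA (hcard.trans (by omega))
  dim := by
    have hN : ∅ ≠ N := by
      rintro rfl
      have := h.finrank_le_card
      rw [Finset.card_empty] at this
      omega
    obtain ⟨φ, hφ⟩ := hexp ∅ (Finset.empty_subset N) (by simp)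
    obtain ⟨F, hF, -⟩ := h.exists_facet hφ hN
    exact facetComplex_hasDim hW ⟨F, hF⟩
  link_stellated v hv := by
    obtain ⟨σ, hσ, hreach⟩ := h.exists_reflTransGen_link (d := 2 * k) (k := k) hW (by omega) hv
      fun A hA hcard => hexp A hA (by omega)
    exact ⟨σ, _, hσ, hreach, FaceIsomorphic.refl _⟩

/-- The neighbourliness puts the points in general position, so that the facets are simplices. -/
theorem memW_of_faces_eq_exposedFaces {p : ℕ → W} {N : Finset ℕ} {k : ℕ}
    {Y : PreAbstractSimplicialComplex ℕ} (hW : Module.finrank ℝ W = 2 * k + 3)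
    (hN : 2 * k + 3 ≤ N.card) (hY : Y.faces = exposedFaces p N) (hn : Y.IsNeighbourly (k + 1))
    (h₀ : ∃ φ, Exposes p N ∅ φ) (h₁ : ∀ i ∈ N, ∃ φ, Exposes p N {i} φ) :
    Y.MemW k (2 * k + 1) := by
  have : FiniteDimensional ℝ W := Module.finite_of_finrank_pos (by omega)
  have hvert : ∀ i ∈ N, {i} ∈ exposedFaces p N := fun i hi =>
    ⟨Finset.singleton_nonempty i, by rintro rfl; simp at hN, h₁ i hi⟩
  have hexp := exists_exposes_of_isNeighbourly hY hn (by omega) h₀ hvert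
  have h : GeneralPosition p N := ⟨hW.trans_le hN, fun A hA hcard =>
    linearIndepOn_of_exposes hexp hA (by omega)⟩
  rw [h.eq_facetComplex hY]
  exact h.memW_facetComplex hW hexp

end ExposedFaces

section Polytope

section AffineFunctions

variable {E : Type*} [AddCommGroup E] [Module ℝ E]

theorem nonpos_of_mem_convexHull {s : Set E} {a : E →ᵃ[ℝ] ℝ} (ha : ∀ x ∈ s, a x ≤ 0) :
    ∀ y ∈ convexHull ℝ s, a y ≤ 0 :=
  convexHull_min ha ((convex_Iic (0 : ℝ)).affine_preimage a)

theorem convexHull_inter_zero_eq {V : Finset E} {a : E →ᵃ[ℝ] ℝ} (ha : ∀ x ∈ V, a x ≤ 0) :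
    {y ∈ convexHull ℝ (V : Set E) | a y = 0} = convexHull ℝ ({x ∈ V | a x = 0} : Finset E) := by
  refine Set.Subset.antisymm ?_ fun y hy => ⟨convexHull_mono (Finset.filter_subset _ V) hy, ?_⟩
  · rintro y ⟨hy, hay⟩
    obtain ⟨w, hw, hw₁, rfl⟩ := Finset.mem_convexHull'.1 hy
    have hsum := V.map_affineCombination id w hw₁ a
    rw [V.affineCombination_eq_linear_combination _ w hw₁,
      V.affineCombination_eq_linear_combination _ w hw₁] at hsum
    have hterm := (Finset.sum_eq_zero_iff_of_nonpos fun x hx =>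
      mul_nonpos_of_nonneg_of_nonpos (hw x hx) (ha x hx)).1 (hsum.symm.trans hay)
    have hsupp : ∀ x ∈ V, w x ≠ 0 → a x = 0 := fun x hx hwx =>
      (mul_eq_zero.1 (hterm x hx)).resolve_left hwx
    refine Finset.mem_convexHull'.2 ⟨w, fun x hx => hw x (Finset.mem_filter.1 hx).1, ?_, ?_⟩
    · rw [Finset.sum_filter_of_ne hsupp, hw₁]
    · exact Finset.sum_filter_of_ne fun x hx hne => hsupp x hx (left_ne_zero_of_smul hne)
  · exact convexHull_min (fun x hx => show a x = 0 from (Finset.mem_filter.1 hx).2)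
      ((convex_singleton (0 : ℝ)).affine_preimage a) hy

variable [TopologicalSpace E]

theorem exists_affineMap_of_isExposed {P F : Set E} (h : IsExposed ℝ P F) (hF : F.Nonempty) :
    ∃ a : E →ᵃ[ℝ] ℝ, (∀ x ∈ P, a x ≤ 0) ∧ F = {x ∈ P | a x = 0} := by
  obtain ⟨l, rfl⟩ := h hF
  obtain ⟨b, hb, hmax⟩ := hF
  refine ⟨l.toLinearMap.toAffineMap - AffineMap.const ℝ E (l b), fun x hx => ?_, ?_⟩
  · simpa using hmax x hx
  · refine Set.ext fun x => and_congr_right fun hx => ?_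
    simp only [AffineMap.coe_sub, AffineMap.coe_const, LinearMap.coe_toAffineMap, Pi.sub_apply,
      Function.const_apply, ContinuousLinearMap.coe_coe, sub_eq_zero]
    exact ⟨fun h => (hmax x hx).antisymm (h b hb), fun h y hy => h ▸ hmax y hy⟩

end AffineFunctions

variable {E : Type*} [NormedAddCommGroup E] [NormedSpace ℝ E]

theorem exists_convexIndependent_convexHull_eq (s : Finset E) :
    ∃ V : Finset E, ConvexIndependent ℝ ((↑) : ↥(V : Set E) → E) ∧
      convexHull ℝ (s : Set E) = convexHull ℝ (V : Set E) := by
  have hfin : ((convexHull ℝ (s : Set E)).extremePoints ℝ).Finite :=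
    s.finite_toSet.subset extremePoints_convexHull_subset
  refine ⟨hfin.toFinset, ?_, ?_⟩
  · rw [hfin.coe_toFinset]
    exact (convex_convexHull ℝ _).convexIndependent_extremePoints
  · rw [hfin.coe_toFinset, ← (hfin.isClosed_convexHull ℝ).closure_eq,
      closure_convexHull_extremePoints (s.finite_toSet.isCompact_convexHull ℝ)
        (convex_convexHull ℝ _)]

variable [FiniteDimensional ℝ E] {V B : Finset E}

theorem isExposed_of_affineMap {P : Set E} {a : E →ᵃ[ℝ] ℝ} (ha : ∀ x ∈ P, a x ≤ 0) :
    IsExposed ℝ P {x ∈ P | a x = 0} := by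
  rintro ⟨b, hb, hab⟩
  have hlinear (x y : E) : a.linear y ≤ a.linear x ↔ a y ≤ a x := by
    rw [← sub_nonpos, ← map_sub, ← vsub_eq_sub, AffineMap.linearMap_vsub, vsub_eq_sub, sub_nonpos]
  refine ⟨LinearMap.toContinuousLinearMap a.linear, Set.ext fun x => and_congr_right fun hx => ?_⟩
  simp only [LinearMap.coe_toContinuousLinearMap', hlinear]
  exact ⟨fun h y hy => (ha y hy).trans h.ge, fun h => (ha x hx).antisymm (hab ▸ h b hb)⟩

theorem isExposed_convexHull_iff (hV : ConvexIndependent ℝ ((↑) : ↥(V : Set E) → E)) (hBV : B ⊆ V)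
    (hB : B.Nonempty) :
    IsExposed ℝ (convexHull ℝ (V : Set E)) (convexHull ℝ (B : Set E)) ↔
      ∃ a : E →ᵃ[ℝ] ℝ, (∀ x ∈ B, a x = 0) ∧ ∀ x ∈ V, x ∉ B → a x < 0 := by
  constructor
  · intro h
    obtain ⟨a, ha, heq⟩ := exists_affineMap_of_isExposed h hB.to_set.convexHull
    refine ⟨a, fun x hx => (heq.subset (subset_convexHull ℝ _ hx)).2, fun x hx hxB => ?_⟩
    have hxV := subset_convexHull ℝ (V : Set E) hx
    exact (ha x hxV).lt_of_ne fun h0 => hxB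
      (convexIndependent_set_iff_inter_convexHull_subset.1 hV B hBV ⟨hx, heq.superset ⟨hxV, h0⟩⟩)
  · rintro ⟨a, hzero, hneg⟩
    have hle : ∀ x ∈ V, a x ≤ 0 := fun x hx => by
      by_cases hxB : x ∈ B
      · exact (hzero x hxB).le
      · exact (hneg x hx hxB).le
    have hfilter : ({x ∈ V | a x = 0} : Finset E) = B := by
      ext x
      refine ⟨fun hx => by_contra fun hxB => ?_, fun hx => Finset.mem_filter.2 ⟨hBV hx, hzero x hx⟩⟩
      obtain ⟨hxV, hx₀⟩ := Finset.mem_filter.1 hx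
      exact (hneg x hxV hxB).ne hx₀
    rw [← hfilter, ← convexHull_inter_zero_eq hle]
    exact isExposed_of_affineMap (nonpos_of_mem_convexHull hle)

theorem exposedPoints_convexHull_eq (hV : ConvexIndependent ℝ ((↑) : ↥(V : Set E) → E)) :
    (convexHull ℝ (V : Set E)).exposedPoints ℝ = V := by
  refine (exposedPoints_subset_extremePoints.trans extremePoints_convexHull_subset).antisymm ?_
  intro v hv
  obtain ⟨l, c, hl, hc⟩ := geometric_hahn_banach_closed_point (convex_convexHull ℝ _)
    ((V.finite_toSet.subset Set.sdiff_subset).isClosed_convexHull ℝ)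
    (convexIndependent_set_iff_notMem_convexHull_sdiff.1 hV v hv)
  rw [mem_exposedPoints_iff_exposed_singleton]
  have h := (isExposed_convexHull_iff hV (Finset.singleton_subset_iff.2 hv)
    (Finset.singleton_nonempty v)).2 ⟨l.toLinearMap.toAffineMap - AffineMap.const ℝ E (l v),
      by simp, fun x hx hxv => ?_⟩
  · simpa using h
  · simpa using (hl x (subset_convexHull ℝ _ ⟨hx, by simpa using hxv⟩)).trans hc

theorem mem_boundaryFaces_iff {n : ℕ} {V B : Finset (EuclideanSpace ℝ (Fin n))}
    (hV : ConvexIndependent ℝ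
      ((↑) : ↥(V : Set (EuclideanSpace ℝ (Fin n))) → EuclideanSpace ℝ (Fin n))) :
    B ∈ boundaryFaces (convexHull ℝ (V : Set (EuclideanSpace ℝ (Fin n)))) ↔
      B.Nonempty ∧ B ⊂ V ∧ IsExposed ℝ (convexHull ℝ (V : Set (EuclideanSpace ℝ (Fin n))))
        (convexHull ℝ (B : Set (EuclideanSpace ℝ (Fin n)))) := by
  rw [boundaryFaces, Set.mem_ofPred_eq, exposedPoints_convexHull_eq hV, Finset.coe_subset]
  refine and_congr_right fun _ => ?_
  constructor
  · rintro ⟨hBV, hexp, hne⟩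
    exact ⟨hBV.ssubset_of_ne fun h => hne (h ▸ rfl), hexp⟩
  · rintro ⟨hBV, hexp⟩
    refine ⟨hBV.subset, hexp, fun heq => ?_⟩
    have hVB : (V : Set (EuclideanSpace ℝ (Fin n))) ⊆ B := fun x hx =>
      convexIndependent_set_iff_inter_convexHull_subset.1 hV B hBV.subset
        ⟨hx, heq ▸ subset_convexHull ℝ _ hx⟩
    exact hBV.not_subset hVB

end Polytope

section Homogenization

variable {ι E : Type*} [AddCommGroup E] [Module ℝ E] {x : ι → E} {o : ι} {N A : Finset ι}

/-- The homogenisation of the points `x i`, with origin `x o`: they are placed at height `1` over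
the vector space parallel to their affine span, so that affine functions become linear. -/
def homogenize (x : ι → E) (o : ι) (i : ι) : vectorSpan ℝ (Set.range x) × ℝ :=
  (⟨x i -ᵥ x o, vsub_mem_vectorSpan ℝ (Set.mem_range_self i) (Set.mem_range_self o)⟩, 1)

theorem exists_affineMap_eq_dual_homogenize
    (φ : Module.Dual ℝ (vectorSpan ℝ (Set.range x) × ℝ)) :
    ∃ a : E →ᵃ[ℝ] ℝ, ∀ i, a (x i) = φ (homogenize x o i) := by
  obtain ⟨l, hl⟩ := LinearMap.exists_extend (φ ∘ₗ LinearMap.inl ℝ _ ℝ)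
  refine ⟨l.toAffineMap + AffineMap.const ℝ E (φ (0, 1) - l (x o)), fun i => ?_⟩
  have hsplit : homogenize x o i = ((homogenize x o i).1, 0) + (0, 1) := by simp [homogenize]
  have hfst : l (x i - x o) = φ ((homogenize x o i).1, 0) :=
    LinearMap.congr_fun hl (homogenize x o i).1
  rw [hsplit, map_add, ← hfst, map_sub]
  simp only [AffineMap.coe_add, AffineMap.coe_const, LinearMap.coe_toAffineMap, Pi.add_apply,
    Function.const_apply]
  ring

theorem exists_dual_homogenize_eq_affineMap (a : E →ᵃ[ℝ] ℝ) :
    ∃ φ : Module.Dual ℝ (vectorSpan ℝ (Set.range x) × ℝ), ∀ i, φ (homogenize x o i) = a (x i) :=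
  ⟨(a.linear ∘ₗ Submodule.subtype _).coprod (LinearMap.toSpanSingleton ℝ ℝ (a (x o))), fun i => by
    have h : a.linear (x i - x o) = a (x i) - a (x o) := a.linearMap_vsub (x i) (x o)
    simp [homogenize, -map_sub, h]⟩

theorem exists_exposes_homogenize_iff :
    (∃ φ, Exposes (homogenize x o) N A φ) ↔ A ⊆ N ∧ ∃ a : E →ᵃ[ℝ] ℝ,
      (∀ i ∈ A, a (x i) = 0) ∧ ∀ i ∈ N, i ∉ A → a (x i) < 0 := by
  constructor
  · rintro ⟨φ, hA, hzero, hneg⟩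
    obtain ⟨a, ha⟩ := exists_affineMap_eq_dual_homogenize (o := o) φ
    exact ⟨hA, a, by simpa only [ha] using ⟨hzero, hneg⟩⟩
  · rintro ⟨hA, a, hzero, hneg⟩
    obtain ⟨φ, hφ⟩ := exists_dual_homogenize_eq_affineMap (x := x) (o := o) a
    exact ⟨φ, hA, by simpa only [hφ] using hzero, by simpa only [hφ] using hneg⟩

theorem exists_exposes_homogenize_empty : ∃ φ, Exposes (homogenize x o) N ∅ φ :=
  exists_exposes_homogenize_iff.2 ⟨Finset.empty_subset N, AffineMap.const ℝ E (-1), by simp⟩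

end Homogenization

section HomogenizedPolytope

variable {ι E : Type*} [NormedAddCommGroup E] [NormedSpace ℝ E] [FiniteDimensional ℝ E]
  [DecidableEq E] {x : ι → E} {o : ι} {N B : Finset ι}

theorem isExposed_convexHull_image_iff (hx : Set.InjOn x N)
    (hV : ConvexIndependent ℝ ((↑) : ↥(N.image x : Set E) → E)) (hBN : B ⊆ N) (hB : B.Nonempty) :
    IsExposed ℝ (convexHull ℝ (N.image x : Set E)) (convexHull ℝ (B.image x : Set E)) ↔
      ∃ φ, Exposes (homogenize x o) N B φ := by
  have hmem : ∀ i ∈ N, x i ∈ B.image x ↔ i ∈ B := fun i hi => by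
    rw [← Finset.mem_coe, Finset.coe_image, hx.mem_image_iff hBN hi, Finset.mem_coe]
  rw [isExposed_convexHull_iff hV (Finset.image_subset_image hBN) (hB.image x),
    exists_exposes_homogenize_iff, and_iff_right hBN]
  simp +contextual only [Finset.forall_mem_image, hmem]

theorem exists_exposes_homogenize_singleton (hx : Set.InjOn x N)
    (hV : ConvexIndependent ℝ ((↑) : ↥(N.image x : Set E) → E)) :
    ∀ i ∈ N, ∃ φ, Exposes (homogenize x o) N {i} φ := by
  intro i hi
  refine (isExposed_convexHull_image_iff hx hV (Finset.singleton_subset_iff.2 hi)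
    (Finset.singleton_nonempty i)).1 ?_
  have hexp : x i ∈ (convexHull ℝ (N.image x : Set E)).exposedPoints ℝ := by
    rw [exposedPoints_convexHull_eq hV]
    exact Finset.mem_image_of_mem x hi
  simpa using mem_exposedPoints_iff_exposed_singleton.1 hexp

end HomogenizedPolytope

theorem finrank_vectorSpan_convexHull {E : Type*} [AddCommGroup E] [Module ℝ E] (s : Set E) :
    Module.finrank ℝ (vectorSpan ℝ (convexHull ℝ s)) = Module.finrank ℝ (vectorSpan ℝ s) := by
  rw [← direction_affineSpan, affineSpan_convexHull, direction_affineSpan]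

theorem finrank_vectorSpan_lt_card {E : Type*} [AddCommGroup E] [Module ℝ E] {V : Finset E}
    (hV : V.Nonempty) : Module.finrank ℝ (vectorSpan ℝ (V : Set E)) < V.card := by
  classical
  have hle := finrank_vectorSpan_image_finset_le ℝ id V (Nat.sub_add_cancel hV.card_pos).symm
  rw [Finset.image_id] at hle
  have := hV.card_pos
  omega

theorem exists_enumeration {E : Type*} [DecidableEq E] {V : Finset E} (hV : V.Nonempty) :
    ∃ (x : ℕ → E) (N : Finset ℕ), Set.InjOn x N ∧ N.image x = V ∧ Set.range x = V := by
  obtain ⟨x, hx⟩ := V.countable_toSet.exists_eq_range hV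
  have hsurj : Set.univ.SurjOn x V := by rw [Set.SurjOn, Set.image_univ, hx]
  obtain ⟨N, -, hinj, hN⟩ := Finset.exists_subset_injOn_image_eq_of_surjOn Set.univ V hsurj
  exact ⟨x, N, hinj, hN, hx.symm⟩

theorem faceIsomorphic_of_image_mem_iff {V W : Type*} [DecidableEq V] [Nonempty W] {x : W → V}
    {N : Finset W} {F : Set (Finset V)} {G : Set (Finset W)} (hx : Set.InjOn x N)
    (hF : ∀ A ∈ F, A ⊆ N.image x) (hG : ∀ B ∈ G, B ⊆ N)
    (hFG : ∀ B ⊆ N, B.image x ∈ F ↔ B ∈ G) : FaceIsomorphic F G := by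
  have hinv : ∀ B ⊆ N, Function.invFunOn x N '' (B.image x : Finset V) = (B : Set W) :=
    fun B hB => by rw [Finset.coe_image, hx.invFunOn_image hB]
  refine ⟨Function.invFunOn x N, ?_, fun B => ⟨fun hB => ?_, ?_⟩⟩
  · refine (Function.invFunOn_injOn_image x N).mono ?_
    rintro v ⟨A, hA, hv⟩
    exact Finset.coe_image (f := x) ▸ hF A hA hv
  · exact ⟨B.image x, (hFG B (hG B hB)).2 hB, (hinv B (hG B hB)).symm⟩
  · rintro ⟨A, hA, hBA⟩
    obtain ⟨B', hB', rfl⟩ := Finset.subset_image_iff.1 (hF A hA)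
    rw [hinv B' hB', Finset.coe_inj] at hBA
    exact hBA ▸ (hFG B' hB').1 hA

theorem faceIsomorphic_boundaryFaces_exposedFaces {ι : Type*} [Nonempty ι] {n : ℕ}
    [DecidableEq (EuclideanSpace ℝ (Fin n))] {x : ι → EuclideanSpace ℝ (Fin n)} {o : ι}
    {N : Finset ι} (hx : Set.InjOn x N)
    (hV : ConvexIndependent ℝ
      ((↑) : ↥(N.image x : Set (EuclideanSpace ℝ (Fin n))) → EuclideanSpace ℝ (Fin n))) :
    FaceIsomorphic (boundaryFaces (convexHull ℝ (N.image x : Set (EuclideanSpace ℝ (Fin n)))))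
      (exposedFaces (homogenize x o) N) := by
  refine faceIsomorphic_of_image_mem_iff hx
    (fun A hA => ((mem_boundaryFaces_iff hV).1 hA).2.1.subset)
    (fun B ⟨_, _, _, hφ⟩ => hφ.subset) fun B hBN => ?_
  have hproper : B.image x ⊂ N.image x ↔ B ≠ N := by
    rw [Finset.ssubset_iff_subset_ne, and_iff_right (Finset.image_subset_image hBN), Ne,
      ← Finset.coe_inj, Finset.coe_image, Finset.coe_image,
      hx.image_eq_image_iff hBN Set.Subset.rfl, Finset.coe_inj]
  rw [mem_boundaryFaces_iff hV, Finset.image_nonempty, hproper]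
  exact and_congr_right fun hB => and_congr_right fun _ =>
    isExposed_convexHull_image_iff hx hV hBN hB

theorem proposition3p13 {V : Type*} [DecidableEq V] (k : ℕ) (S : PreAbstractSimplicialComplex V)
    (hS : S.IsPolytopalSphere (2 * k + 1)) (hn : S.IsNeighbourly (k + 1)) :
    S.MemW k (2 * k + 1) := by
  classical
  obtain ⟨n, _, ⟨⟨s, rfl⟩, -⟩, hdim, hiso⟩ := hS
  obtain ⟨P, hP, hsP⟩ := exists_convexIndependent_convexHull_eq s
  rw [hsP, finrank_vectorSpan_convexHull] at hdim
  rw [hsP] at hiso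
  have hne : P.Nonempty := by
    rw [Finset.nonempty_iff_ne_empty]
    rintro rfl
    rw [Finset.coe_empty, vectorSpan_empty, finrank_bot] at hdim
    omega
  obtain ⟨x, N, hx, rfl, hrange⟩ := exists_enumeration hne
  have hfinrank : Module.finrank ℝ (vectorSpan ℝ (Set.range x) × ℝ) = 2 * k + 3 := by
    rw [Module.finrank_prod, Module.finrank_self, hrange, hdim]
  have hcard : 2 * k + 3 ≤ N.card := by
    have := finrank_vectorSpan_lt_card hne
    rw [Finset.card_image_of_injOn hx] at this
    omega
  obtain ⟨f, hf, hfaces⟩ :=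
    (hiso.trans (faceIsomorphic_boundaryFaces_exposedFaces (o := 0) hx hP)).exists_map
  exact memW_of_map hf <| memW_of_faces_eq_exposedFaces hfinrank hcard hfaces
    (isNeighbourly_map hf hn) exists_exposes_homogenize_empty
    (exists_exposes_homogenize_singleton hx hP)
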